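/- There is an absolute constant $c_3>0$ such that the following holds. Let $p,n,r\ge 1$ and $T\ge 0$ be integers, let $S^*\in\mathbb{R}^{p\times p}$ be symmetric positive definite with smallest and largest eigenvalues $S_p\le S_1$, and let $L^*\in\mathbb{R}^{p\times p}$ be symmetric (for instance positive semidefinite) with $\operatorname{rank}(L^*)\le r$. Let $c_{\mathcal T}>1$, $0<c_{\mathcal H}<1$, $m>0$, and let $M,\eta$ be real. Put $$\eta_0=c_{\mathcal H}m-\sqrt{1+M^2-2m},\qquad \rho_0=\frac1{1+c_{\mathcal T}}-\sqrt{1-\eta_0^2},$$ $$\rho_1=\Bigl(\sqrt{1+M^2\eta^2-2m\eta}+\sqrt{1-\eta_0^2}\Bigr)(1+c_{\mathcal T}),\qquad \rho_2=\Bigl(\frac{\eta_0}{\sqrt{1-\eta_0^2}}+1\Bigr)(1+c_{\mathcal T}),$$ $$R=(1+\sqrt r)\,\|L^*\|_2+\frac{c_3\rho_2}{1-\rho_1}\sqrt{\frac{rp}{n}} .$$ Assume that $\eta_0>0$, that $\rho_1<1$, that $$\|L^*\|_2\le\frac1{1+\sqrt r}\left(\frac{S_p}{1+\sqrt{1-\rho_0^2}}-\frac{S_1\sqrt{1-\rho_0^2}}{1+\sqrt{1-\rho_0^2}}-\frac{c_3\rho_2}{1-\rho_1}\sqrt{\frac{rp}{n}}\right),$$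 and that $m$ and $M$ are valid curvature (restricted strong convexity and smoothness) constants of the loss $F$ below on the symmetric matrices with $\|L\|_2\le R$, namely $m\le (S_1+R)^{-2}$ and $(S_p-R)^{-2}\le M$. Let $X_1,\dots,X_n$ be i.i.d. $\mathcal N(0,(S^*+L^*)^{-1})$ vectors, $C=\frac1n\sum_i X_iX_i^T$, and $F(L)=-\log\det(S^*+L)+\langle S^*+L,C\rangle$, with $\nabla F(L)=-(S^*+L)^{-1}+C$. Let $\mathbb U_k$ be the set of subspaces of $\mathbb{R}^{p\times p}$ spanned by $k$ atoms $uv^T$ with unit vectors $u,v$, let $\mathcal P_W$ be the orthogonal projection onto $W$, and let $A_k$ be a best rank-$k$ approximation of $A$ in Frobenius norm. Let $\mathcal T_t$ and $\mathcal H_t$ ($t\ge0$; they may be random and may vary with $t$) be maps that assign to every matrix $A$ subspaces $W=\mathcal T_t(A)\in\mathbb U_r$ and $V=\mathcal H_t(A)\in\mathbb U_{2r}$ with $\|A-\mathcal P_WA\|_F\le c_{\mathcal T}\|A-A_r\|_F$ and $\|\mathcal P_VA\|_F\ge c_{\mathcal H}\|A_{2r}\|_F$. The AP-LVM iterates are $L^0=0$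 and $$L^{t+1}=\mathcal P_{\mathcal T_t(B^t)}B^t,\qquad B^t=L^t-\eta\,\mathcal P_{\mathcal H_t(\nabla F(L^t))}\nabla F(L^t).$$ Then there is a number $a'$ with $0<a'\le(1+\sqrt r)\,\|L^*\|_2+\frac{c_3\rho_2}{1-\rho_1}\sqrt{\frac{rp}{n}}$ such that, with probability at least $1-2\exp(-p)$, for all $t=1,\dots,T$ the minimum eigenvalue of $L^t$ is at least $-a'$. (As $L^t$ need not be symmetric, this means that every complex eigenvalue of $L^t$ has real part at least $-a'$, and moreover that $x^TL^tx\ge-a'\|x\|^2$ for all $x\in\mathbb{R}^p$.) -/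

import Mathlib

open MeasureTheory ProbabilityTheory

noncomputable section

namespace LVM

/-- Real `p × p` matrices. -/
abbrev Mat (p : ℕ) : Type := Matrix (Fin p) (Fin p) ℝ

/-- The list of entries of a matrix as a vector of the Euclidean space `ℝ^(p × p)`. The norm and the
inner product of that space are the Frobenius norm and the trace inner product. -/
def vec {p : ℕ} : Mat p ≃ₗ[ℝ] EuclideanSpace ℝ (Fin p × Fin p) where
  toFun A := WithLp.toLp 2 (fun ij => A ij.1 ij.2)
  invFun x := Matrix.of fun i j => x (i, j)
  map_add' _ _ := rfl
  map_smul' _ _ := rfl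
  left_inv _ := rfl
  right_inv _ := rfl

/-- The Frobenius norm. -/
def frobNorm {p : ℕ} (A : Mat p) : ℝ := ‖vec A‖

/-- The spectral norm, i.e. the operator norm for the Euclidean norm on `ℝ^p`. -/
def specNorm {p : ℕ} (A : Mat p) : ℝ := ‖Matrix.toEuclideanCLM (n := Fin p) (𝕜 := ℝ) A‖

/-- The largest eigenvalue (used for symmetric matrices). -/
def maxEig {p : ℕ} (A : Mat p) : ℝ := sSup (spectrum ℝ A)

/-- The smallest eigenvalue (used for symmetric matrices). -/
def minEig {p : ℕ} (A : Mat p) : ℝ := sInf (spectrum ℝ A)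

/-- The minimum eigenvalue of `A` is at least `b`. The iterates of the algorithm need not be
symmetric, so the property is stated for all real square matrices: every complex eigenvalue has real
part at least `b`, and so has the Rayleigh quotient at every vector. For a symmetric matrix each of
the two is equivalent to `b ≤ minEig A`. -/
def MinEigAtLeast {p : ℕ} (A : Mat p) (b : ℝ) : Prop :=
  (∀ z ∈ spectrum ℂ (A.map (fun x : ℝ => (x : ℂ))), b ≤ z.re) ∧
    ∀ x : Fin p → ℝ, b * (x ⬝ᵥ x) ≤ x ⬝ᵥ A.mulVec x

/-- The orthogonal projection of `A` onto a subspace `W` of matrices, for the trace inner product. -/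
def proj {p : ℕ} (W : Submodule ℝ (Mat p)) (A : Mat p) : Mat p :=
  vec.symm ((W.map (vec (p := p) : Mat p →ₗ[ℝ] EuclideanSpace ℝ (Fin p × Fin p))).starProjection
    (vec A))

/-- The rank-`k` matrix subspaces: the spans of `k` atoms `u vᵀ` with unit vectors `u`, `v`. -/
def rankSubspaces (p k : ℕ) : Set (Submodule ℝ (Mat p)) :=
  {W | ∃ u v : Fin k → EuclideanSpace ℝ (Fin p), (∀ i, ‖u i‖ = 1) ∧ (∀ i, ‖v i‖ = 1) ∧
    W = Submodule.span ℝ (Set.range fun i => (Matrix.vecMulVec (u i) (v i) : Mat p))}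

/-- `X` is a best rank-`k` approximation of `A` in Frobenius norm. -/
def IsBestRankApprox {p : ℕ} (k : ℕ) (A X : Mat p) : Prop :=
  X.rank ≤ k ∧ ∀ Y : Mat p, Y.rank ≤ k → frobNorm (A - X) ≤ frobNorm (A - Y)

/-- `𝓣` is a `c`-approximate tail projection of rank `k`:
`𝓣 A` is a rank-`k` subspace `W` with `‖A - P_W A‖_F ≤ c ‖A - A_k‖_F`. -/
def IsTailProj {p : ℕ} (k : ℕ) (c : ℝ) (𝓣 : Mat p → Submodule ℝ (Mat p)) : Prop :=
  ∀ A : Mat p, 𝓣 A ∈ rankSubspaces p k ∧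
    ∃ X : Mat p, IsBestRankApprox k A X ∧ frobNorm (A - proj (𝓣 A) A) ≤ c * frobNorm (A - X)

/-- `𝓗` is a `c`-approximate head projection of rank `k`:
`𝓗 A` is a rank-`k` subspace `V` with `‖P_V A‖_F ≥ c ‖A_k‖_F`. -/
def IsHeadProj {p : ℕ} (k : ℕ) (c : ℝ) (𝓗 : Mat p → Submodule ℝ (Mat p)) : Prop :=
  ∀ A : Mat p, 𝓗 A ∈ rankSubspaces p k ∧
    ∃ X : Mat p, IsBestRankApprox k A X ∧ c * frobNorm X ≤ frobNorm (proj (𝓗 A) A)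

/-- The sample covariance matrix `C = n⁻¹ ∑ᵢ Xᵢ Xᵢᵀ`. -/
def sampleCov {p n : ℕ} (X : Fin n → EuclideanSpace ℝ (Fin p)) : Mat p :=
  (n : ℝ)⁻¹ • ∑ i, (Matrix.vecMulVec (X i) (X i) : Mat p)

/-- The gradient `-(S + L)⁻¹ + C` of `F(L) = -log det (S + L) + ⟨S + L, C⟩`. -/
def grad {p : ℕ} (S C L : Mat p) : Mat p := -(S + L)⁻¹ + C

/-- The iterates of the algorithm with approximate projections: `L⁰ = 0` and
`L^(t+1) = 𝓣(L^t - η 𝓗(∇F(L^t)))`, where a matrix is projected onto the subspace that `𝓣`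
(resp. `𝓗`) returns for it. The approximate projections may change with the iteration. -/
def apLVM {p : ℕ} (𝓣 𝓗 : ℕ → Mat p → Submodule ℝ (Mat p)) (S C : Mat p) (η : ℝ) : ℕ → Mat p
  | 0 => 0
  | t + 1 =>
    let L := apLVM 𝓣 𝓗 S C η t
    let G := grad S C L
    let B := L - η • proj (𝓗 t G) G
    proj (𝓣 t B) B

/-- `η₀ = c_H m - √(1 + M² - 2m)`. -/
def eta0 (cH m M : ℝ) : ℝ := cH * m - √(1 + M ^ 2 - 2 * m)

/-- `ρ₀ = 1 / (1 + c_T) - √(1 - η₀²)`. -/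
def rho0 (cT cH m M : ℝ) : ℝ := 1 / (1 + cT) - √(1 - eta0 cH m M ^ 2)

/-- `ρ₁ = (√(1 + M²η² - 2mη) + √(1 - η₀²)) (1 + c_T)`. -/
def rho1 (cT cH m M η : ℝ) : ℝ :=
  (√(1 + M ^ 2 * η ^ 2 - 2 * m * η) + √(1 - eta0 cH m M ^ 2)) * (1 + cT)

/-- `ρ₂ = (η₀ / √(1 - η₀²) + 1) (1 + c_T)`. -/
def rho2 (cT cH m M : ℝ) : ℝ :=
  (eta0 cH m M / √(1 - eta0 cH m M ^ 2) + 1) * (1 + cT)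

/-- The statistical error `(c₃ ρ₂ / (1 - ρ₁)) √(rp/n)`. -/
def statErr (c₃ cT cH m M η : ℝ) (p n r : ℕ) : ℝ :=
  c₃ * rho2 cT cH m M / (1 - rho1 cT cH m M η) * √((r : ℝ) * p / n)

/-- The bound `(1 + √r) ‖L‖₂ + (c₃ ρ₂ / (1 - ρ₁)) √(rp/n)`. -/
def radius (c₃ cT cH m M η : ℝ) {p : ℕ} (n r : ℕ) (L : Mat p) : ℝ :=
  (1 + √(r : ℝ)) * specNorm L + statErr c₃ cT cH m M η p n r

end LVM

end

noncomputable section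

namespace LVM

/-! Write `R` for the radius and `E` for the statistical error; the witness is `a' = R`. On the
event `‖C - (S + L)⁻¹‖₂ ≤ 512 ‖(S + L)⁻¹‖₂ √(p/n)`, every iterate has rank at most `r` and satisfies
`‖L^t - L‖_F ≤ √r ‖L‖₂ + E`. Hence `‖L^t‖₂ ≤ R`, which bounds all Rayleigh quotients, and through
them the complex eigenvalues, below by `-R`. The invariant holds at `L⁰ = 0` because `rank L ≤ r`.
It persists because one step multiplies the error by at most `ρ₁ < 1` and adds noise of at most `(1
- ρ₁) E` (`frobNorm_step_le`, `noise_le_statErr`).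

Three points carry the argument. The iterates need not be symmetric, so `grad_curvature` treats `S +
L^t` as a perturbation of a scalar matrix; the assumption on `‖L‖₂` forces `(S₁ + R) / (S_p - R) ≤
5/4`, which is close enough to scalar. For `c₃` to be absolute, the noise has to be measured
relative to `m`: the head estimate may be run on the gradient scaled by some `τ ≤ 2 / m`, without
loss in `η₀` (`exists_scaling`). Finally, the hypotheses force `p ≤ n`, where Gaussian concentration
on a net of the sphere gives the event its probability (`measure_sampleCov_deviation_le`). -/

/-! ### Spectral norm, Frobenius norm and trace inner product -/

lemma specNorm_nonneg {p : ℕ} (A : Mat p) : 0 ≤ specNorm A := norm_nonneg _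

lemma specNorm_add_le {p : ℕ} (A B : Mat p) : specNorm (A + B) ≤ specNorm A + specNorm B := by
  unfold specNorm
  rw [map_add]
  exact norm_add_le _ _

lemma specNorm_transpose {p : ℕ} (A : Mat p) : specNorm A.transpose = specNorm A := by
  have := Matrix.l2_opNorm_conjTranspose A
  rwa [Matrix.conjTranspose_eq_transpose_of_trivial] at this

lemma norm_toLp_mulVec_le {p : ℕ} (A : Mat p) (x : Fin p → ℝ) :
    ‖WithLp.toLp 2 (A.mulVec x)‖ ≤ specNorm A * ‖WithLp.toLp 2 x‖ :=
  (Matrix.toEuclideanCLM (n := Fin p) (𝕜 := ℝ) A).le_opNorm (WithLp.toLp 2 x)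

lemma specNorm_le_of_forall {p : ℕ} {A : Mat p} {c : ℝ} (hc : 0 ≤ c)
    (h : ∀ x : Fin p → ℝ, ‖WithLp.toLp 2 (A.mulVec x)‖ ≤ c * ‖WithLp.toLp 2 x‖) :
    specNorm A ≤ c :=
  ContinuousLinearMap.opNorm_le_bound _ hc fun x => h x.ofLp

lemma norm_toLp_sq {p : ℕ} (x : Fin p → ℝ) : ‖WithLp.toLp 2 x‖ ^ 2 = x ⬝ᵥ x := by
  rw [EuclideanSpace.real_norm_sq_eq]
  simp [dotProduct, sq]

lemma abs_dotProduct_le {p : ℕ} (x y : Fin p → ℝ) :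
    |x ⬝ᵥ y| ≤ ‖WithLp.toLp 2 x‖ * ‖WithLp.toLp 2 y‖ := by
  have := abs_real_inner_le_norm (WithLp.toLp 2 x : EuclideanSpace ℝ (Fin p)) (WithLp.toLp 2 y)
  rwa [EuclideanSpace.inner_toLp_toLp, dotProduct_comm, star_trivial] at this

lemma abs_dotProduct_mulVec_le {p : ℕ} (A : Mat p) (x : Fin p → ℝ) :
    |x ⬝ᵥ A.mulVec x| ≤ specNorm A * (x ⬝ᵥ x) := by
  have h1 := abs_dotProduct_le x (A.mulVec x)
  have h2 := norm_toLp_mulVec_le A x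
  rw [← norm_toLp_sq]
  nlinarith [norm_nonneg (WithLp.toLp 2 x : EuclideanSpace ℝ (Fin p))]

/-- The trace inner product. -/
def frobInner {p : ℕ} (A B : Mat p) : ℝ := inner ℝ (vec A) (vec B)

lemma frobInner_eq_sum {p : ℕ} (A B : Mat p) : frobInner A B = ∑ i, ∑ j, A i j * B i j := by
  simp only [frobInner, vec, PiLp.inner_apply, RCLike.inner_apply, conj_trivial,
    Fintype.sum_prod_type]
  exact Finset.sum_congr rfl fun i _ => Finset.sum_congr rfl fun j _ => mul_comm _ _

lemma frobInner_self {p : ℕ} (A : Mat p) : frobInner A A = frobNorm A ^ 2 :=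
  real_inner_self_eq_norm_sq _

lemma frobInner_eq_trace {p : ℕ} (A B : Mat p) : frobInner A B = (A.transpose * B).trace := by
  rw [frobInner_eq_sum, Finset.sum_comm]
  simp [Matrix.trace, Matrix.mul_apply]

lemma abs_frobInner_le {p : ℕ} (A B : Mat p) : |frobInner A B| ≤ frobNorm A * frobNorm B :=
  abs_real_inner_le_norm _ _

lemma frobNorm_nonneg {p : ℕ} (A : Mat p) : 0 ≤ frobNorm A := norm_nonneg _

lemma frobNorm_sq_eq_sum_col {p : ℕ} (A : Mat p) :
    frobNorm A ^ 2 = ∑ j, ‖WithLp.toLp 2 (A.col j)‖ ^ 2 := by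
  rw [← frobInner_self, frobInner_eq_sum, Finset.sum_comm]
  simp [norm_toLp_sq, dotProduct, Matrix.col]

lemma frobNorm_transpose {p : ℕ} (A : Mat p) : frobNorm A.transpose = frobNorm A := by
  have : frobNorm A.transpose ^ 2 = frobNorm A ^ 2 := by
    rw [← frobInner_self, ← frobInner_self, frobInner_eq_sum, frobInner_eq_sum, Finset.sum_comm]
    rfl
  exact (sq_eq_sq₀ (frobNorm_nonneg _) (frobNorm_nonneg _)).1 this

lemma frobNorm_mul_le_left {p : ℕ} (A B : Mat p) :
    frobNorm (A * B) ≤ specNorm A * frobNorm B := by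
  refine (sq_le_sq₀ (frobNorm_nonneg _) (mul_nonneg (specNorm_nonneg _) (frobNorm_nonneg _))).1 ?_
  rw [mul_pow, frobNorm_sq_eq_sum_col, frobNorm_sq_eq_sum_col, Finset.mul_sum]
  refine Finset.sum_le_sum fun j _ => ?_
  rw [← mul_pow]
  exact pow_le_pow_left₀ (norm_nonneg _) (norm_toLp_mulVec_le A (B.col j)) 2

lemma frobNorm_mul_le_right {p : ℕ} (A B : Mat p) :
    frobNorm (A * B) ≤ frobNorm A * specNorm B := by
  rw [← frobNorm_transpose, Matrix.transpose_mul, mul_comm, ← specNorm_transpose B,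
    ← frobNorm_transpose A]
  exact frobNorm_mul_le_left _ _

lemma specNorm_le_frobNorm {p : ℕ} (A : Mat p) : specNorm A ≤ frobNorm A := by
  refine specNorm_le_of_forall (frobNorm_nonneg _) fun x => ?_
  refine (sq_le_sq₀ (norm_nonneg _) (mul_nonneg (frobNorm_nonneg _) (norm_nonneg _))).1 ?_
  rw [mul_pow, EuclideanSpace.real_norm_sq_eq, ← frobNorm_transpose, frobNorm_sq_eq_sum_col,
    Finset.sum_mul]
  refine Finset.sum_le_sum fun i _ => ?_
  rw [← mul_pow, ← sq_abs]
  exact pow_le_pow_left₀ (abs_nonneg _) (abs_dotProduct_le (A i) x) 2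

/-! ### Rank and the comparison of the two norms -/

/-- The matrix of the orthogonal projection onto the column space. -/
def colProj {p : ℕ} (Z : Mat p) : Mat p :=
  (Matrix.toEuclideanCLM (n := Fin p) (𝕜 := ℝ)).symm
    ((LinearMap.range (Matrix.toEuclideanLin (𝕜 := ℝ) Z)).starProjection)

lemma toEuclideanCLM_colProj {p : ℕ} (Z : Mat p) :
    Matrix.toEuclideanCLM (n := Fin p) (𝕜 := ℝ) (colProj Z) =
      (LinearMap.range (Matrix.toEuclideanLin (𝕜 := ℝ) Z)).starProjection :=
  StarAlgEquiv.apply_symm_apply _ _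

lemma toEuclideanCLM_injective {p : ℕ} {A B : Mat p}
    (h : Matrix.toEuclideanCLM (n := Fin p) (𝕜 := ℝ) A = Matrix.toEuclideanCLM (𝕜 := ℝ) B) :
    A = B :=
  (Matrix.toEuclideanCLM (n := Fin p) (𝕜 := ℝ)).injective h

lemma colProj_mul {p : ℕ} (Z : Mat p) : colProj Z * Z = Z := by
  apply toEuclideanCLM_injective
  rw [map_mul, toEuclideanCLM_colProj]
  ext1 x
  exact Submodule.starProjection_eq_self_iff.2 ⟨x, rfl⟩

lemma colProj_transpose {p : ℕ} (Z : Mat p) : (colProj Z).transpose = colProj Z := by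
  rw [← Matrix.conjTranspose_eq_transpose_of_trivial, ← Matrix.star_eq_conjTranspose]
  apply toEuclideanCLM_injective
  rw [map_star, toEuclideanCLM_colProj]
  exact isSelfAdjoint_starProjection _

lemma colProj_mul_self {p : ℕ} (Z : Mat p) : colProj Z * colProj Z = colProj Z := by
  apply toEuclideanCLM_injective
  rw [map_mul, toEuclideanCLM_colProj]
  exact Submodule.isIdempotentElem_starProjection _

lemma trace_colProj {p : ℕ} (Z : Mat p) : (colProj Z).trace = Z.rank := by
  have h : Matrix.trace (colProj Z) = LinearMap.trace ℝ _ (Matrix.toEuclideanLin (colProj Z)) := by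
    rw [Matrix.toEuclideanLin_eq_toLin_orthonormal, Matrix.trace_toLin_eq]
  have h2 : Matrix.toEuclideanLin (colProj Z) =
      ((LinearMap.range (Matrix.toEuclideanLin (𝕜 := ℝ) Z)).starProjection :
        EuclideanSpace ℝ (Fin p) →ₗ[ℝ] EuclideanSpace ℝ (Fin p)) := by
    rw [← Matrix.coe_toEuclideanCLM_eq_toEuclideanLin, toEuclideanCLM_colProj]
  have h3 : LinearMap.IsProj (LinearMap.range (Matrix.toEuclideanLin (𝕜 := ℝ) Z))
      ((LinearMap.range (Matrix.toEuclideanLin (𝕜 := ℝ) Z)).starProjection :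
        EuclideanSpace ℝ (Fin p) →ₗ[ℝ] EuclideanSpace ℝ (Fin p)) :=
    ⟨fun x => Submodule.starProjection_apply_mem _ x,
      fun x hx => Submodule.starProjection_eq_self_iff.2 hx⟩
  rw [h, h2, h3.trace, Matrix.rank_eq_finrank_range_toLin Z
    (EuclideanSpace.basisFun (Fin p) ℝ).toBasis (EuclideanSpace.basisFun (Fin p) ℝ).toBasis,
    ← Matrix.toEuclideanLin_eq_toLin_orthonormal]

lemma frobNorm_colProj {p : ℕ} (Z : Mat p) : frobNorm (colProj Z) = √(Z.rank : ℝ) := by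
  have h : frobNorm (colProj Z) ^ 2 = Z.rank := by
    rw [← frobInner_self, frobInner_eq_trace, colProj_transpose, colProj_mul_self, trace_colProj]
  rw [← h, Real.sqrt_sq (frobNorm_nonneg _)]

/-- With `P` the projection onto the column space, `Z = P Z` gives `⟨Z, N⟩ = ⟨P, N Zᵀ⟩`, and `‖P‖_F
= √(rank Z)`. This replaces the duality of nuclear and spectral norm and needs no singular values.
-/
lemma abs_frobInner_le_of_rank_le {p k : ℕ} {Z : Mat p} (hZ : Z.rank ≤ k) (N : Mat p) :
    |frobInner Z N| ≤ √(k : ℝ) * specNorm N * frobNorm Z := by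
  have h : frobInner Z N = frobInner (colProj Z) (N * Z.transpose) := by
    conv_lhs => rw [← colProj_mul Z]
    rw [frobInner_eq_trace, frobInner_eq_trace, Matrix.transpose_mul, Matrix.mul_assoc,
      Matrix.trace_mul_comm, Matrix.mul_assoc]
  rw [h]
  calc _ ≤ frobNorm (colProj Z) * frobNorm (N * Z.transpose) := abs_frobInner_le _ _
    _ ≤ √(k : ℝ) * (specNorm N * frobNorm Z.transpose) := by
      rw [frobNorm_colProj]
      have := frobNorm_mul_le_left N Z.transpose
      have := frobNorm_nonneg (N * Z.transpose)
      gcongr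
    _ = _ := by rw [frobNorm_transpose, mul_assoc]

lemma frobNorm_le_of_rank_le {p k : ℕ} {Z : Mat p} (hZ : Z.rank ≤ k) :
    frobNorm Z ≤ √(k : ℝ) * specNorm Z := by
  have h := abs_frobInner_le_of_rank_le hZ Z
  rw [frobInner_self, abs_of_nonneg (sq_nonneg _), sq] at h
  rcases (frobNorm_nonneg Z).eq_or_lt with h0 | h0
  · rw [← h0]; exact mul_nonneg (Real.sqrt_nonneg _) (specNorm_nonneg _)
  · exact le_of_mul_le_mul_right h h0

lemma rank_add_le {p : ℕ} (A B : Mat p) : (A + B).rank ≤ A.rank + B.rank := by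
  rw [Matrix.rank, Matrix.rank, Matrix.rank, Matrix.mulVecLin_add]
  exact (Submodule.finrank_mono (LinearMap.range_add_le _ _)).trans
    (Submodule.finrank_add_le_finrank_add_finrank _ _)

lemma rank_sub_le {p : ℕ} (A B : Mat p) : (A - B).rank ≤ A.rank + B.rank := by
  have h : (-B).rank = B.rank := by
    rw [Matrix.rank, Matrix.rank]
    have : (-B).mulVecLin = -B.mulVecLin := by ext; simp
    rw [this, LinearMap.range_neg]
  rw [sub_eq_add_neg, ← h]
  exact rank_add_le _ _

lemma rank_smul_le {p : ℕ} (s : ℝ) (A : Mat p) : (s • A).rank ≤ A.rank := by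
  have h : s • A = (s • (1 : Mat p)) * A := by simp
  rw [h]
  exact Matrix.rank_mul_le_right _ _

lemma rank_sum_le {p : ℕ} {ι : Type*} (s : Finset ι) (f : ι → Mat p) :
    (∑ i ∈ s, f i).rank ≤ ∑ i ∈ s, (f i).rank := by
  classical
  induction s using Finset.induction_on with
  | empty => simp
  | insert a s ha ih =>
    rw [Finset.sum_insert ha, Finset.sum_insert ha]
    exact (rank_add_le _ _).trans (by gcongr)

lemma rank_le_of_mem_rankSubspaces {p k : ℕ} {W : Submodule ℝ (Mat p)}
    (hW : W ∈ rankSubspaces p k) {A : Mat p} (hA : A ∈ W) : A.rank ≤ k := by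
  obtain ⟨u, v, -, -, rfl⟩ := hW
  obtain ⟨c, rfl⟩ := (Submodule.mem_span_range_iff_exists_fun ℝ).1 hA
  refine (rank_sum_le _ _).trans ?_
  calc _ ≤ ∑ _i : Fin k, 1 := Finset.sum_le_sum fun i _ =>
        (rank_smul_le _ _).trans (Matrix.rank_vecMulVec_le _ _)
    _ = k := by simp

/-! ### Projections onto rank-`k` subspaces and best approximations -/

lemma vec_proj {p : ℕ} (W : Submodule ℝ (Mat p)) (A : Mat p) : vec (proj W A) =
    (W.map (vec (p := p) : Mat p →ₗ[ℝ] EuclideanSpace ℝ (Fin p × Fin p))).starProjection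
      (vec A) := by
  rw [proj, LinearEquiv.apply_symm_apply]

lemma proj_mem {p : ℕ} (W : Submodule ℝ (Mat p)) (A : Mat p) : proj W A ∈ W := by
  have h : vec (proj W A) ∈
      W.map (vec (p := p) : Mat p →ₗ[ℝ] EuclideanSpace ℝ (Fin p × Fin p)) := by
    rw [vec_proj]
    exact Submodule.starProjection_apply_mem _ _
  obtain ⟨B, hB, hB'⟩ := h
  rwa [← vec.injective hB']

lemma proj_add {p : ℕ} (W : Submodule ℝ (Mat p)) (A B : Mat p) :
    proj W (A + B) = proj W A + proj W B := by
  simp [proj]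

lemma proj_sub {p : ℕ} (W : Submodule ℝ (Mat p)) (A B : Mat p) :
    proj W (A - B) = proj W A - proj W B := by
  simp [proj]

lemma proj_smul {p : ℕ} (W : Submodule ℝ (Mat p)) (s : ℝ) (A : Mat p) :
    proj W (s • A) = s • proj W A := by
  simp [proj]

lemma frobInner_proj_self {p : ℕ} (W : Submodule ℝ (Mat p)) (A : Mat p) :
    frobInner (proj W A) A = frobNorm (proj W A) ^ 2 := by
  have h := Submodule.re_inner_starProjection_eq_normSq (𝕜 := ℝ)
    (W.map (vec (p := p) : Mat p →ₗ[ℝ] EuclideanSpace ℝ (Fin p × Fin p))) (vec A)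
  rw [frobInner, frobNorm, vec_proj]
  exact h

lemma frobNorm_add_le {p : ℕ} (A B : Mat p) : frobNorm (A + B) ≤ frobNorm A + frobNorm B := by
  rw [frobNorm, map_add]; exact norm_add_le _ _

lemma frobNorm_sub_le {p : ℕ} (A B : Mat p) : frobNorm (A - B) ≤ frobNorm A + frobNorm B := by
  rw [frobNorm, map_sub]; exact norm_sub_le _ _

lemma frobNorm_smul {p : ℕ} (s : ℝ) (A : Mat p) : frobNorm (s • A) = |s| * frobNorm A := by
  rw [frobNorm, map_smul, norm_smul, Real.norm_eq_abs]; rfl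

lemma frobNorm_sub_smul_sq {p : ℕ} (A B : Mat p) (s : ℝ) : frobNorm (A - s • B) ^ 2 =
    frobNorm A ^ 2 - 2 * s * frobInner A B + s ^ 2 * frobNorm B ^ 2 := by
  rw [frobNorm, map_sub, map_smul, norm_sub_sq_real, inner_smul_right, norm_smul, mul_pow,
    Real.norm_eq_abs, sq_abs]
  simp only [frobNorm, frobInner]
  ring

lemma frobInner_comm {p : ℕ} (A B : Mat p) : frobInner A B = frobInner B A :=
  real_inner_comm _ _

lemma frobInner_add_right {p : ℕ} (A B C : Mat p) :
    frobInner A (B + C) = frobInner A B + frobInner A C := by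
  simp [frobInner, inner_add_right]

lemma frobNorm_sub_proj_sq {p : ℕ} (W : Submodule ℝ (Mat p)) (A : Mat p) :
    frobNorm (A - proj W A) ^ 2 = frobNorm A ^ 2 - frobNorm (proj W A) ^ 2 := by
  have h := frobNorm_sub_smul_sq A (proj W A) 1
  rw [one_smul, frobInner_comm, frobInner_proj_self] at h
  rw [h]; ring

lemma frobNorm_proj_le {p : ℕ} (W : Submodule ℝ (Mat p)) (A : Mat p) :
    frobNorm (proj W A) ≤ frobNorm A := by
  refine (sq_le_sq₀ (frobNorm_nonneg _) (frobNorm_nonneg _)).1 ?_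
  nlinarith [frobNorm_sub_proj_sq W A, sq_nonneg (frobNorm (A - proj W A))]

/-- The noise enters the algorithm only through such projections, so it costs `√k` times its
spectral norm and not its full Frobenius norm. -/
lemma frobNorm_proj_le_of_rank {p k : ℕ} {W : Submodule ℝ (Mat p)}
    (hW : W ∈ rankSubspaces p k) (N : Mat p) : frobNorm (proj W N) ≤ √(k : ℝ) * specNorm N := by
  have h := abs_frobInner_le_of_rank_le (rank_le_of_mem_rankSubspaces hW (proj_mem W N)) N
  rw [frobInner_proj_self, abs_of_nonneg (sq_nonneg _), sq] at h
  rcases (frobNorm_nonneg (proj W N)).eq_or_lt with h0 | h0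
  · rw [← h0]; exact mul_nonneg (Real.sqrt_nonneg _) (specNorm_nonneg _)
  · exact le_of_mul_le_mul_right h h0

/-- A best rank-`k` approximation of `A` captures every direction of rank at most `k`. -/
lemma IsBestRankApprox.frobInner_le {p k : ℕ} {A X Z : Mat p} (hX : IsBestRankApprox k A X)
    (hZ : Z.rank ≤ k) : frobInner A Z ≤ frobNorm X * frobNorm Z := by
  -- The competitors are all multiples `s • Y`; good choices of `s` replace the singular value
  -- decomposition.
  have key : ∀ s : ℝ, ∀ Y : Mat p, Y.rank ≤ k → frobNorm X ^ 2 - 2 * frobInner A X ≤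
      - 2 * s * frobInner A Y + s ^ 2 * frobNorm Y ^ 2 := by
    intro s Y hY
    have h := hX.2 (s • Y) ((rank_smul_le _ _).trans hY)
    have h1 := pow_le_pow_left₀ (frobNorm_nonneg _) h 2
    have h2 := frobNorm_sub_smul_sq A X 1
    rw [one_smul] at h2
    rw [h2, frobNorm_sub_smul_sq] at h1
    linarith
  have hAX : frobInner A X = frobNorm X ^ 2 := by
    rcases (frobNorm_nonneg X).eq_or_lt with h0 | h0
    · have := abs_frobInner_le A X
      rw [← h0, mul_zero] at this
      rw [← h0, abs_nonpos_iff.1 this]; norm_num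
    · have h := key (frobInner A X / frobNorm X ^ 2) X hX.1
      have h2 : 0 < frobNorm X ^ 2 := by positivity
      field_simp at h
      nlinarith [sq_nonneg (frobInner A X - frobNorm X ^ 2)]
  rcases (frobNorm_nonneg Z).eq_or_lt with h0 | h0
  · have := (le_abs_self _).trans (abs_frobInner_le A Z)
    rw [← h0, mul_zero] at this ⊢
    exact this
  · have h := key (frobNorm X / frobNorm Z) Z hZ
    rw [hAX] at h
    rcases (frobNorm_nonneg X).eq_or_lt with h1 | h1
    -- If `X = 0`, the choice `s = ‖X‖ / ‖Z‖` is void; the minimizing `s = ⟨A, Z⟩ / ‖Z‖²` shows that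
    -- `A` is orthogonal to `Z`.
    · by_contra hc
      have h3 := key (frobInner A Z / frobNorm Z ^ 2) Z hZ
      rw [hAX, ← h1] at h3
      rw [← h1] at hc
      have h2 : 0 < frobNorm Z ^ 2 := by positivity
      field_simp at h3
      nlinarith
    · field_simp at h
      nlinarith

/-! ### Curvature of the loss near scalar matrices -/

/-- Centring at the midpoint of the spectrum turns eigenvalue bounds into a norm ball, a form that
survives adding a matrix that is not symmetric. -/
lemma specNorm_isHermitian_sub_le {p : ℕ} (hp : 0 < p) {S : Mat p} (hS : S.IsHermitian) :
    specNorm (S - ((maxEig S + minEig S) / 2) • (1 : Mat p)) ≤ (maxEig S - minEig S) / 2 := by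
  have hspec := hS.spectrum_real_eq_range_eigenvalues
  have hfin : (spectrum ℝ S).Finite := by rw [hspec]; exact Set.finite_range _
  have hmem : ∀ i, minEig S ≤ hS.eigenvalues i ∧ hS.eigenvalues i ≤ maxEig S := fun i =>
    ⟨csInf_le hfin.bddBelow (by rw [hspec]; exact ⟨i, rfl⟩),
      le_csSup hfin.bddAbove (by rw [hspec]; exact ⟨i, rfl⟩)⟩
  have h0 : 0 ≤ (maxEig S - minEig S) / 2 := by
    have := hmem ⟨0, hp⟩
    linarith
  refine specNorm_le_of_forall h0 fun x => ?_
  set y : EuclideanSpace ℝ (Fin p) := WithLp.toLp 2 x with hy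
  set a := (maxEig S + minEig S) / 2
  set T := Matrix.toEuclideanCLM (n := Fin p) (𝕜 := ℝ) (S - a • (1 : Mat p)) with hT
  change ‖T y‖ ≤ _
  have hsymm : ∀ u v, inner ℝ u (T v) = inner ℝ (T u) v := by
    intro u v
    have hadj : ContinuousLinearMap.adjoint T = T := by
      have hs : star (S - a • (1 : Mat p)) = S - a • (1 : Mat p) := by
        rw [Matrix.star_eq_conjTranspose, Matrix.conjTranspose_sub, hS.eq]
        simp
      rw [← ContinuousLinearMap.star_eq_adjoint, hT, ← map_star, hs]
    rw [← ContinuousLinearMap.adjoint_inner_left, hadj]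
  have heig : ∀ i, T (hS.eigenvectorBasis i) = (hS.eigenvalues i - a) • hS.eigenvectorBasis i := by
    intro i
    have := hS.mulVec_eigenvectorBasis i
    ext j
    have hj := congrFun this j
    simp only [Pi.smul_apply, smul_eq_mul] at hj
    rw [hT, Matrix.ofLp_toEuclideanCLM, Matrix.sub_mulVec, Matrix.smul_mulVec]
    simp [hj, sub_mul]
  refine (sq_le_sq₀ (norm_nonneg _) (mul_nonneg h0 (norm_nonneg _))).1 ?_
  rw [mul_pow, ← hS.eigenvectorBasis.sum_sq_inner_right, ← hS.eigenvectorBasis.sum_sq_inner_right y,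
    Finset.mul_sum]
  refine Finset.sum_le_sum fun i _ => ?_
  rw [hsymm, heig, real_inner_smul_left, mul_pow]
  refine mul_le_mul_of_nonneg_right ?_ (sq_nonneg _)
  have := hmem i
  exact sq_le_sq' (by simp only [a]; linarith) (by simp only [a]; linarith)

/-- If `Δ` lies in the disk of radius `d ‖D‖` around `c D`, then `D` lies in the inverted disk. -/
lemma frobNorm_sq_le_of_disk {p : ℕ} {Δ D : Mat p} {c d : ℝ} (hd : 0 ≤ d) (hdc : d < c)
    (h : frobNorm (Δ - c • D) ≤ d * frobNorm D) :
    frobNorm Δ ^ 2 ≤ (c + d) * frobInner Δ D := by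
  have h1 := pow_le_pow_left₀ (frobNorm_nonneg _) h 2
  rw [frobNorm_sub_smul_sq, mul_pow] at h1
  have hk : 0 < c ^ 2 - d ^ 2 := by nlinarith
  -- This is `h1` multiplied by `c² - d²`: inversion maps the disk to a disk around `c Δ / (c² -
  -- d²)`. Pairing with `Δ` and cancelling `c - d` then gives the claim.
  have h2 : frobNorm ((c ^ 2 - d ^ 2) • D - c • Δ) ^ 2 ≤ (d * frobNorm Δ) ^ 2 := by
    rw [frobNorm_sub_smul_sq, frobNorm_smul, abs_of_pos hk]
    have : frobInner ((c ^ 2 - d ^ 2) • D) Δ = (c ^ 2 - d ^ 2) * frobInner Δ D := by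
      simp [frobInner, real_inner_comm, inner_smul_right]
    rw [this]
    nlinarith
  have h3 := (sq_le_sq₀ (frobNorm_nonneg _) (mul_nonneg hd (frobNorm_nonneg _))).1 h2
  have h4 := abs_frobInner_le ((c ^ 2 - d ^ 2) • D - c • Δ) Δ
  have h5 : frobInner ((c ^ 2 - d ^ 2) • D - c • Δ) Δ =
      (c ^ 2 - d ^ 2) * frobInner Δ D - c * frobNorm Δ ^ 2 := by
    rw [← frobInner_self]
    simp [frobInner, inner_sub_left, real_inner_comm, inner_smul_right]
  rw [h5] at h4
  have h6 := (abs_le.1 h4).1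
  have h7 : (c - d) * frobNorm Δ ^ 2 ≤ (c - d) * ((c + d) * frobInner Δ D) := by
    nlinarith [frobNorm_nonneg Δ]
  exact le_of_mul_le_mul_left h7 (by linarith)

lemma sub_mul_norm_le_norm_mulVec {p : ℕ} {A : Mat p} {a b : ℝ} (ha : 0 ≤ a)
    (hA : specNorm (A - a • (1 : Mat p)) ≤ b) (x : Fin p → ℝ) :
    (a - b) * ‖WithLp.toLp 2 x‖ ≤ ‖WithLp.toLp 2 (A.mulVec x)‖ := by
  have h := norm_toLp_mulVec_le (A - a • (1 : Mat p)) x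
  have h2 : (WithLp.toLp 2 ((A - a • (1 : Mat p)).mulVec x) : EuclideanSpace ℝ (Fin p)) =
      WithLp.toLp 2 (A.mulVec x) - a • WithLp.toLp 2 x := by
    rw [Matrix.sub_mulVec, Matrix.smul_mulVec, Matrix.one_mulVec]; rfl
  rw [h2] at h
  have h3 := norm_sub_norm_le (a • (WithLp.toLp 2 x : EuclideanSpace ℝ (Fin p)))
    (WithLp.toLp 2 (A.mulVec x))
  rw [norm_smul, Real.norm_of_nonneg ha, norm_sub_rev] at h3
  nlinarith [norm_nonneg (WithLp.toLp 2 x : EuclideanSpace ℝ (Fin p))]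

lemma isUnit_det_of_specNorm_sub_le {p : ℕ} {A : Mat p} {a b : ℝ} (ha : 0 ≤ a) (hab : b < a)
    (hA : specNorm (A - a • (1 : Mat p)) ≤ b) : IsUnit A.det := by
  rw [← Matrix.isUnit_iff_isUnit_det, ← Matrix.mulVec_injective_iff_isUnit]
  refine (injective_iff_map_eq_zero A.mulVecLin).2 fun x hx => ?_
  have h := sub_mul_norm_le_norm_mulVec ha hA x
  rw [Matrix.mulVecLin_apply] at hx
  rw [hx, WithLp.toLp_zero, norm_zero] at h
  have h2 : ‖(WithLp.toLp 2 x : EuclideanSpace ℝ (Fin p))‖ = 0 := by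
    nlinarith [norm_nonneg (WithLp.toLp 2 x : EuclideanSpace ℝ (Fin p))]
  simpa using h2

lemma specNorm_inv_le {p : ℕ} {A : Mat p} {a b : ℝ} (ha : 0 ≤ a) (hab : b < a)
    (hA : specNorm (A - a • (1 : Mat p)) ≤ b) : specNorm A⁻¹ ≤ (a - b)⁻¹ := by
  have hu := isUnit_det_of_specNorm_sub_le ha hab hA
  refine specNorm_le_of_forall (by rw [inv_nonneg]; linarith) fun x => ?_
  have h := sub_mul_norm_le_norm_mulVec ha hA (A⁻¹.mulVec x)
  rw [Matrix.mulVec_mulVec, Matrix.mul_nonsing_inv _ hu, Matrix.one_mulVec] at h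
  rw [inv_mul_eq_div, le_div_iff₀ (by linarith), mul_comm]
  exact h

lemma posDef_of_specNorm_sub_le {p : ℕ} {A : Mat p} {a b : ℝ} (hab : b < a)
    (hs : A.IsSymm) (hA : specNorm (A - a • (1 : Mat p)) ≤ b) : A.PosDef := by
  refine Matrix.PosDef.of_dotProduct_mulVec_pos ?_ fun x hx => ?_
  · rw [Matrix.IsHermitian, Matrix.conjTranspose_eq_transpose_of_trivial]; exact hs
  · have h := abs_dotProduct_mulVec_le (A - a • (1 : Mat p)) x
    rw [Matrix.sub_mulVec, Matrix.smul_mulVec, Matrix.one_mulVec, dotProduct_sub,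
      dotProduct_smul, smul_eq_mul] at h
    rw [star_trivial]
    have hx2 : 0 < x ⬝ᵥ x := by
      rw [← norm_toLp_sq]
      have : 0 < ‖(WithLp.toLp 2 x : EuclideanSpace ℝ (Fin p))‖ := by simpa using hx
      positivity
    nlinarith [(abs_le.1 h).1]

lemma frobNorm_ge_of_specNorm_sub_le_left {p : ℕ} {A : Mat p} {a b : ℝ} (ha : 0 ≤ a)
    (hA : specNorm (A - a • (1 : Mat p)) ≤ b) (X : Mat p) :
    (a - b) * frobNorm X ≤ frobNorm (A * X) := by
  have h := frobNorm_mul_le_left (A - a • (1 : Mat p)) X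
  have h2 : a • X = A * X - (A - a • (1 : Mat p)) * X := by
    rw [sub_mul, smul_mul_assoc, one_mul]; abel
  have h3 := frobNorm_sub_le (A * X) ((A - a • (1 : Mat p)) * X)
  rw [← h2, frobNorm_smul, abs_of_nonneg ha] at h3
  nlinarith [frobNorm_nonneg X]

lemma frobNorm_ge_of_specNorm_sub_le_right {p : ℕ} {A : Mat p} {a b : ℝ} (ha : 0 ≤ a)
    (hA : specNorm (A - a • (1 : Mat p)) ≤ b) (X : Mat p) :
    (a - b) * frobNorm X ≤ frobNorm (X * A) := by
  rw [← frobNorm_transpose (X * A), Matrix.transpose_mul, ← frobNorm_transpose X]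
  refine frobNorm_ge_of_specNorm_sub_le_left ha ?_ _
  rw [← specNorm_transpose, Matrix.transpose_sub, Matrix.transpose_transpose,
    Matrix.transpose_smul, Matrix.transpose_one]
  exact hA

/-- Writing `A = a + N` and `B = a + K`, the remainder is `a N D + a D K + N D K`, of size at most
`2ab + b²` times `‖D‖_F`. -/
lemma frobNorm_mul_mul_sub_le {p : ℕ} {A B : Mat p} {a b : ℝ} (ha : 0 ≤ a) (hb : 0 ≤ b)
    (hA : specNorm (A - a • (1 : Mat p)) ≤ b) (hB : specNorm (B - a • (1 : Mat p)) ≤ b)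
    (D : Mat p) :
    frobNorm (A * D * B - a ^ 2 • D) ≤ ((a + b) ^ 2 - a ^ 2) * frobNorm D := by
  set N := A - a • (1 : Mat p)
  set K := B - a • (1 : Mat p)
  have e : A * D * B - a ^ 2 • D = a • (N * D) + a • (D * K) + N * D * K := by
    have hA' : A = a • (1 : Mat p) + N := by simp [N]
    have hB' : B = a • (1 : Mat p) + K := by simp [K]
    rw [hA', hB']
    simp only [add_mul, mul_add, smul_mul_assoc, mul_smul_comm, one_mul, mul_one, smul_smul, sq,
      smul_add]
    abel
  have hD := frobNorm_nonneg D
  have h1 : frobNorm (N * D) ≤ b * frobNorm D := (frobNorm_mul_le_left _ _).trans (by gcongr)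
  have h2 : frobNorm (D * K) ≤ frobNorm D * b := (frobNorm_mul_le_right _ _).trans (by gcongr)
  have h3 : frobNorm (N * D * K) ≤ b * frobNorm D * b :=
    (frobNorm_mul_le_right _ _).trans (by gcongr; exact specNorm_nonneg _)
  rw [e]
  have h4 := frobNorm_add_le (a • (N * D) + a • (D * K)) (N * D * K)
  have h5 := frobNorm_add_le (a • (N * D)) (a • (D * K))
  rw [frobNorm_smul, frobNorm_smul, abs_of_nonneg ha] at h5
  nlinarith

/-- The gradient is strongly monotone and Lipschitz near the multiples of the identity, also
along directions that are not symmetric. -/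
lemma grad_curvature {p : ℕ} {S L₁ L₂ : Mat p} (C : Mat p) {a b : ℝ} (hb : 0 ≤ b) (hab : b < a)
    (hab2 : (a + b) ^ 2 < 2 * a ^ 2)
    (h₁ : specNorm (S + L₁ - a • (1 : Mat p)) ≤ b) (h₂ : specNorm (S + L₂ - a • (1 : Mat p)) ≤ b) :
    1 / (a + b) ^ 2 * frobNorm (L₁ - L₂) ^ 2 ≤
        frobInner (L₁ - L₂) (grad S C L₁ - grad S C L₂) ∧
      frobNorm (grad S C L₁ - grad S C L₂) ≤ 1 / (a - b) ^ 2 * frobNorm (L₁ - L₂) := by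
  have ha : 0 < a := by linarith
  have hu₁ := isUnit_det_of_specNorm_sub_le ha.le hab h₁
  have hu₂ := isUnit_det_of_specNorm_sub_le ha.le hab h₂
  set D := grad S C L₁ - grad S C L₂ with hD
  -- The resolvent identity, with the factors kept on their sides since nothing commutes.
  have e : L₁ - L₂ = (S + L₁) * D * (S + L₂) := by
    rw [hD, grad, grad]
    have : -(S + L₁)⁻¹ + C - (-(S + L₂)⁻¹ + C) = (S + L₂)⁻¹ - (S + L₁)⁻¹ := by abel
    rw [this, mul_sub, Matrix.mul_nonsing_inv _ hu₁, sub_mul, mul_assoc,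
      Matrix.nonsing_inv_mul _ hu₂]
    simp
  constructor
  · have h := frobNorm_mul_mul_sub_le ha.le hb h₁ h₂ D
    rw [← e] at h
    -- Here `c = a²` and `d = (a + b)² - a²`, so `hab2` is exactly `d < c`, and `c + d = (a + b)²`
    -- is the reciprocal of the convexity constant.
    have h2 := frobNorm_sq_le_of_disk (by nlinarith) (by linarith) h
    rw [add_sub_cancel] at h2
    rw [one_div_mul_eq_div, div_le_iff₀ (by positivity), mul_comm]
    exact h2
  · have h3 := frobNorm_ge_of_specNorm_sub_le_left ha.le h₁ D
    have h4 := frobNorm_ge_of_specNorm_sub_le_right ha.le h₂ ((S + L₁) * D)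
    rw [← e] at h4
    have hab3 : 0 < a - b := by linarith
    rw [one_div_mul_eq_div, le_div_iff₀ (by positivity)]
    nlinarith [frobNorm_nonneg D]

/-- A lower bound on the quadratic form is a lower bound on the complex eigenvalues. -/
lemma minEigAtLeast_of_forall {p : ℕ} {A : Mat p} {b : ℝ}
    (h : ∀ x : Fin p → ℝ, b * (x ⬝ᵥ x) ≤ x ⬝ᵥ A.mulVec x) : MinEigAtLeast A b := by
  refine ⟨fun z hz => ?_, h⟩
  rw [← Matrix.spectrum_toLin', ← Module.End.hasEigenvalue_iff_mem_spectrum] at hz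
  obtain ⟨w, hw, hw0⟩ := hz.exists_hasEigenvector
  rw [Module.End.mem_eigenspace_iff, Matrix.toLin'_apply] at hw
  set u : Fin p → ℝ := fun i => (w i).re with hu
  set v : Fin p → ℝ := fun i => (w i).im with hv
  -- Since `A` is real, the eigenvalue equation splits into real and imaginary parts. In the sum of
  -- the quadratic forms at `u` and `v` the terms with `z.im` cancel.
  have h1 : A.mulVec u = z.re • u - z.im • v := by
    ext i
    have := congrArg Complex.re (congrFun hw i)
    simpa [Matrix.mulVec, dotProduct, hu, hv] using this
  have h2 : A.mulVec v = z.re • v + z.im • u := by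
    ext i
    have := congrArg Complex.im (congrFun hw i)
    simpa [Matrix.mulVec, dotProduct, hu, hv] using this
  have h3 := h u
  have h4 := h v
  rw [h1, dotProduct_sub, dotProduct_smul, dotProduct_smul, smul_eq_mul, smul_eq_mul] at h3
  rw [h2, dotProduct_add, dotProduct_smul, dotProduct_smul, smul_eq_mul, smul_eq_mul,
    dotProduct_comm v u] at h4
  have hpos : 0 < u ⬝ᵥ u + v ⬝ᵥ v := by
    obtain ⟨i, hi⟩ := Function.ne_iff.1 hw0
    have e : u ⬝ᵥ u + v ⬝ᵥ v = ∑ i, Complex.normSq (w i) := by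
      simp [dotProduct, ← Finset.sum_add_distrib, Complex.normSq_apply, hu, hv]
    rw [e]
    exact Finset.sum_pos' (fun _ _ => Complex.normSq_nonneg _)
      ⟨i, Finset.mem_univ _, Complex.normSq_pos.2 hi⟩
  by_contra hc
  push Not at hc
  nlinarith

/-! ### One iteration of the algorithm -/

/-- Expansion of the square. It is used twice: with the step size `η`, and with the auxiliary
scaling `τ` of the head estimate. -/
lemma frobNorm_sub_smul_le {p : ℕ} {Δ D : Mat p} {m M τ : ℝ} (hτ : 0 ≤ τ)
    (hm : m * frobNorm Δ ^ 2 ≤ frobInner Δ D) (hM : frobNorm D ≤ M * frobNorm Δ) :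
    frobNorm (Δ - τ • D) ≤ √(1 + M ^ 2 * τ ^ 2 - 2 * m * τ) * frobNorm Δ := by
  have h1 := pow_le_pow_left₀ (frobNorm_nonneg D) hM 2
  have h2 : frobNorm (Δ - τ • D) ^ 2 ≤ (1 + M ^ 2 * τ ^ 2 - 2 * m * τ) * frobNorm Δ ^ 2 := by
    rw [frobNorm_sub_smul_sq]
    nlinarith [mul_le_mul_of_nonneg_left h1 (sq_nonneg τ), mul_le_mul_of_nonneg_left hm hτ]
  have h3 := Real.sqrt_le_sqrt h2
  rwa [Real.sqrt_sq (frobNorm_nonneg _), Real.sqrt_mul' _ (sq_nonneg _),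
    Real.sqrt_sq (frobNorm_nonneg _)] at h3

/-- An approximate head projection of the gradient captures most of the error `Δ`. The parameter
`τ` is a scaling of the gradient. -/
lemma le_frobNorm_head_proj {p k : ℕ} {Δ D N X : Mat p} {V : Submodule ℝ (Mat p)}
    {m M τ cH : ℝ} (hτ : 0 ≤ τ) (hcH : 0 ≤ cH)
    (hm : m * frobNorm Δ ^ 2 ≤ frobInner Δ D) (hM : frobNorm D ≤ M * frobNorm Δ)
    (hΔ : Δ.rank ≤ k) (hV : V ∈ rankSubspaces p k) (hX : IsBestRankApprox k (D + N) X)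
    (hh : cH * frobNorm X ≤ frobNorm (proj V (D + N))) :
    (cH * m * τ - √(1 + M ^ 2 * τ ^ 2 - 2 * m * τ)) * frobNorm Δ
      - (1 + cH) * τ * (√(k : ℝ) * specNorm N) ≤ frobNorm (proj V Δ) := by
  -- Strong monotonicity makes the gradient correlate with `Δ`, a direction of rank at most `k`, so
  -- its best rank-`k` approximation is large.
  have h1 : m * frobNorm Δ - √(k : ℝ) * specNorm N ≤ frobNorm X := by
    have h := hX.frobInner_le hΔ
    rw [frobInner_comm, frobInner_add_right] at h
    have h2 := (abs_le.1 (abs_frobInner_le_of_rank_le hΔ N)).1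
    rcases (frobNorm_nonneg Δ).eq_or_lt with h0 | h0
    · rw [← h0]
      have := mul_nonneg (Real.sqrt_nonneg (k : ℝ)) (specNorm_nonneg N)
      linarith [frobNorm_nonneg X]
    · refine le_of_mul_le_mul_right ?_ h0
      nlinarith
  have h2 := frobNorm_sub_smul_le hτ hm hM
  have h3 := frobNorm_proj_le_of_rank hV N
  -- The subspace `V` was chosen for the unscaled gradient; linearity of its projection leaves `τ`
  -- free.
  have h4 : τ • proj V (D + N) = proj V Δ - proj V (Δ - τ • D) + τ • proj V N := by
    rw [proj_add, proj_sub, proj_smul, smul_add]; abel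
  have h5 : τ * frobNorm (proj V (D + N)) ≤ frobNorm (proj V Δ) + frobNorm (proj V (Δ - τ • D))
      + τ * frobNorm (proj V N) := by
    rw [← abs_of_nonneg hτ, ← frobNorm_smul, ← frobNorm_smul, abs_of_nonneg hτ, h4]
    exact (frobNorm_add_le _ _).trans (by gcongr; exact frobNorm_sub_le _ _)
  have h6 := frobNorm_proj_le V (Δ - τ • D)
  have h7 := mul_le_mul_of_nonneg_left h3 hτ
  have h8 := mul_le_mul_of_nonneg_left
    ((mul_le_mul_of_nonneg_left h1 hcH).trans hh) hτ
  nlinarith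

/-- Pythagoras turns captured mass into a bound on the missed part. With `s² = 1 - e²` and `x =
‖Δ‖_F`, the identity `(x² - (e x - b)²) s² = (s² x + e b)² - b²` produces the coefficient `e / s`.
-/
lemma frobNorm_sub_proj_le {p : ℕ} {V : Submodule ℝ (Mat p)} {Δ : Mat p} {e b : ℝ}
    (he : 0 < e) (he1 : e < 1) (hb : 0 ≤ b) (h : e * frobNorm Δ - b ≤ frobNorm (proj V Δ)) :
    frobNorm (Δ - proj V Δ) ≤ √(1 - e ^ 2) * frobNorm Δ + e / √(1 - e ^ 2) * b := by
  set s := √(1 - e ^ 2) with hs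
  have hs2 : s ^ 2 = 1 - e ^ 2 := Real.sq_sqrt (by nlinarith)
  have hs0 : 0 < s := Real.sqrt_pos.2 (by nlinarith)
  have hx := frobNorm_nonneg Δ
  set x := frobNorm Δ
  have hq := frobNorm_sub_proj_sq V Δ
  have hnn := frobNorm_nonneg (Δ - proj V Δ)
  have hP := frobNorm_nonneg (proj V Δ)
  have hr : s * x + e / s * b = (s ^ 2 * x + e * b) / s := by field_simp
  rw [hr, le_div_iff₀ hs0]
  rcases le_total 0 (e * x - b) with h0 | h0
  · refine (sq_le_sq₀ (by positivity) (by positivity)).1 ?_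
    have h1 := pow_le_pow_left₀ h0 h 2
    have h2 : frobNorm (Δ - proj V Δ) ^ 2 ≤ x ^ 2 - (e * x - b) ^ 2 := by rw [hq]; linarith
    calc (frobNorm (Δ - proj V Δ) * s) ^ 2 = frobNorm (Δ - proj V Δ) ^ 2 * s ^ 2 := by ring
      _ ≤ (x ^ 2 - (e * x - b) ^ 2) * s ^ 2 := by gcongr
      _ = (s ^ 2 * x + e * b) ^ 2 - b ^ 2 := by rw [hs2]; ring
      _ ≤ _ := by linarith [sq_nonneg b]
  -- When `e x ≤ b` the hypothesis says nothing, but the trivial bound by `x` suffices.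
  · have h1 : frobNorm (Δ - proj V Δ) ≤ x := by
      refine (sq_le_sq₀ hnn hx).1 ?_
      rw [hq]; linarith [sq_nonneg (frobNorm (proj V Δ))]
    have hs1 : s ≤ 1 := by nlinarith
    calc frobNorm (Δ - proj V Δ) * s ≤ x * s := by gcongr
      _ ≤ x * 1 := by gcongr
      _ = s ^ 2 * x + e * (e * x) := by rw [hs2]; ring
      _ ≤ s ^ 2 * x + e * b := by gcongr; linarith

/-- A tail projection is quasi-optimal. -/
lemma frobNorm_tail_proj_sub_le {p k : ℕ} {B Lst X : Mat p} {W : Submodule ℝ (Mat p)} {cT : ℝ}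
    (hcT : 0 ≤ cT) (hL : Lst.rank ≤ k) (hX : IsBestRankApprox k B X)
    (ht : frobNorm (B - proj W B) ≤ cT * frobNorm (B - X)) :
    frobNorm (proj W B - Lst) ≤ (1 + cT) * frobNorm (B - Lst) := by
  have h1 := hX.2 Lst hL
  have h2 : proj W B - Lst = (B - Lst) - (B - proj W B) := by abel
  rw [h2]
  have h3 := frobNorm_sub_le (B - Lst) (B - proj W B)
  nlinarith

/-- One iteration of the algorithm. -/
lemma frobNorm_step_le {p r : ℕ} {L Lst G₀ N B : Mat p} {𝓣 𝓗 : Mat p → Submodule ℝ (Mat p)}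
    {m M τ η cH cT e : ℝ} (hτ : 0 ≤ τ) (hη : 0 ≤ η) (hcH : 0 ≤ cH) (hcT : 0 ≤ cT)
    (he : 0 < e) (he1 : e < 1) (heτ : e ≤ cH * m * τ - √(1 + M ^ 2 * τ ^ 2 - 2 * m * τ))
    (hm : m * frobNorm (L - Lst) ^ 2 ≤ frobInner (L - Lst) (G₀ - N))
    (hM : frobNorm (G₀ - N) ≤ M * frobNorm (L - Lst))
    (hL : L.rank ≤ r) (hLst : Lst.rank ≤ r)
    (h𝓣 : IsTailProj r cT 𝓣) (h𝓗 : IsHeadProj (2 * r) cH 𝓗)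
    (hB : B = L - η • proj (𝓗 G₀) G₀) :
    frobNorm (proj (𝓣 B) B - Lst) ≤
      (√(1 + M ^ 2 * η ^ 2 - 2 * m * η) + √(1 - e ^ 2)) * (1 + cT) * frobNorm (L - Lst)
      + (1 + cT) * (e / √(1 - e ^ 2) * ((1 + cH) * τ) + η) *
        (√((2 * r : ℕ) : ℝ) * specNorm N) := by
  obtain ⟨hW, X, hX, hXt⟩ := h𝓣 B
  obtain ⟨hV, Y, hY, hYh⟩ := h𝓗 G₀
  have hG : G₀ = (G₀ - N) + N := by abel
  set D := G₀ - N
  set Δ := L - Lst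
  set V := 𝓗 G₀
  have hΔ : Δ.rank ≤ 2 * r := (rank_sub_le _ _).trans (by omega)
  have h1 : e * frobNorm Δ - (1 + cH) * τ * (√((2 * r : ℕ) : ℝ) * specNorm N) ≤
      frobNorm (proj V Δ) := by
    refine le_trans ?_ (le_frobNorm_head_proj (N := N) hτ hcH hm hM hΔ hV (hG ▸ hY) (hG ▸ hYh))
    have := mul_le_mul_of_nonneg_right heτ (frobNorm_nonneg Δ)
    linarith
  have hν : 0 ≤ √((2 * r : ℕ) : ℝ) * specNorm N :=
    mul_nonneg (Real.sqrt_nonneg _) (specNorm_nonneg _)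
  have h2 := frobNorm_sub_proj_le he he1 (by positivity) h1
  have h3 := frobNorm_sub_smul_le hη hm hM
  have h4 := frobNorm_proj_le V (Δ - η • D)
  have h5 := mul_le_mul_of_nonneg_left (frobNorm_proj_le_of_rank hV N) hη
  -- The part of `Δ` outside `V` is not moved by the step; the part inside is contracted, up to
  -- noise.
  have h6 : B - Lst = (Δ - proj V Δ) + proj V (Δ - η • D) - η • proj V N := by
    have h0 : B - Lst = Δ - η • proj V G₀ := by rw [hB]; exact sub_right_comm _ _ _
    have hP : proj V G₀ = proj V D + proj V N := by rw [← proj_add, ← hG]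
    rw [h0, hP, proj_sub V Δ, proj_smul, smul_add]
    abel
  have h7 : frobNorm (B - Lst) ≤ frobNorm (Δ - proj V Δ) + frobNorm (proj V (Δ - η • D))
      + η * frobNorm (proj V N) := by
    rw [h6, ← abs_of_nonneg hη, ← frobNorm_smul, abs_of_nonneg hη]
    exact (frobNorm_sub_le _ _).trans (by gcongr; exact frobNorm_add_le _ _)
  refine (frobNorm_tail_proj_sub_le hcT hLst hX hXt).trans ?_
  have h8 : frobNorm (B - Lst) ≤ (√(1 + M ^ 2 * η ^ 2 - 2 * m * η) + √(1 - e ^ 2)) * frobNorm Δ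
      + (e / √(1 - e ^ 2) * ((1 + cH) * τ) + η) * (√((2 * r : ℕ) : ℝ) * specNorm N) := by
    nlinarith
  have h9 := mul_le_mul_of_nonneg_left h8 (show 0 ≤ 1 + cT by linarith)
  linarith

/-! ### Scalar consequences of the assumptions -/

/-- If `c x² - 2 b x + a` has a real root, then it is nonpositive at `a / b`. -/
lemma quadratic_nonpos_of_root {a b c x u : ℝ} (hb : 0 < b) (ha : 0 ≤ a)
    (hx : c * x ^ 2 - 2 * b * x + a = 0) (hu : u * b = a) :
    c * u ^ 2 - 2 * b * u + a ≤ 0 := by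
  have h1 : c * a ≤ b ^ 2 := by
    have : (c * x - b) ^ 2 = b ^ 2 - c * a := by linear_combination c * hx
    nlinarith [sq_nonneg (c * x - b)]
  have h2 : c * u ^ 2 ≤ a := by
    refine le_of_mul_le_mul_right ?_ (pow_pos hb 2)
    calc c * u ^ 2 * b ^ 2 = c * a * a := by rw [← hu]; ring
      _ ≤ b ^ 2 * a := by gcongr
      _ = a * b ^ 2 := by ring
  linarith

/-- A scaling of the gradient of order `1 / m` for which the head condition is as good as for the
unscaled gradient. -/
lemma exists_scaling {m M cH : ℝ} (hm : 0 < m) (hmM : m ≤ M) (hcH : 0 < cH) (hcH1 : cH < 1)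
    (he : 0 < eta0 cH m M) :
    eta0 cH m M < 1 ∧ 1 / 2 < m ∧ M ^ 2 ≤ 2 * m ^ 2 ∧
    ∃ τ, 0 ≤ τ ∧ τ * m ≤ 2 ∧
      eta0 cH m M ≤ cH * m * τ - √(1 + M ^ 2 * τ ^ 2 - 2 * m * τ) := by
  have hnn : 0 ≤ 1 + M ^ 2 - 2 * m := by nlinarith [sq_nonneg (m - 1)]
  have hsq := Real.sq_sqrt hnn
  have hs0 := Real.sqrt_nonneg (1 + M ^ 2 - 2 * m)
  have hdef : eta0 cH m M = cH * m - √(1 + M ^ 2 - 2 * m) := rfl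
  set e := eta0 cH m M
  set w := √(1 + M ^ 2 - 2 * m)
  have hw1 : 1 - m ≤ w := by
    by_contra hc; push Not at hc; nlinarith
  have hw2 : m - 1 ≤ w := by
    by_contra hc; push Not at hc; nlinarith
  have hcm : cH * m < m := by nlinarith
  -- For `m ≤ 1` drop the root; for `m ≥ 1` use that the root is at least `m - 1`.
  have hecH : e ≤ cH := by
    rcases le_total m 1 with h | h <;> nlinarith
  have hM2 : M ^ 2 ≤ 2 * m ^ 2 := by nlinarith [sq_nonneg (m - 1)]
  refine ⟨by linarith, by linarith, hM2, ?_⟩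
  have hq : 0 < 1 - e * cH := by nlinarith
  -- With `u = τ m`, the desired inequality squares to a quadratic in `u` with linear coefficient
  -- `-2(1 - e cH)` and constant term `1 - e²`. By the definition of `η₀` it vanishes at `u = m`,
  -- that is at `τ = 1`, so it is nonpositive at this ratio, which is at most `2` whatever `m` is.
  set u := (1 - e ^ 2) / (1 - e * cH) with hu
  have hue : u * (1 - e * cH) = 1 - e ^ 2 := div_mul_cancel₀ _ hq.ne'
  have hu0 : 0 ≤ u := div_nonneg (by nlinarith) hq.le
  have hu2 : u ≤ 2 := by
    rw [hu, div_le_iff₀ hq]; nlinarith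
  refine ⟨u / m, by positivity, by rw [div_mul_cancel₀ _ hm.ne']; exact hu2, ?_⟩
  have e1 : cH * m * (u / m) = cH * u := by field_simp
  have e2 : 2 * m * (u / m) = 2 * u := by field_simp
  rw [e1, e2]
  have hβ : M ^ 2 * (u / m) ^ 2 = (M ^ 2 / m ^ 2) * u ^ 2 := by field_simp
  have hpos : 0 ≤ cH * u - e := by
    refine (mul_nonneg_iff_of_pos_right hq).1 ?_
    have : (cH * u - e) * (1 - e * cH) = cH - e := by
      calc _ = cH * (u * (1 - e * cH)) - e * (1 - e * cH) := by ring
        _ = _ := by rw [hue]; ring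
    rw [this]; linarith
  rw [hβ]
  set β := M ^ 2 / m ^ 2 with hβdef
  have hβm : β * m ^ 2 = M ^ 2 := by rw [hβdef]; field_simp
  have hat : (β - cH ^ 2) * m ^ 2 - 2 * (1 - e * cH) * m + (1 - e ^ 2) = 0 := by
    have : (cH * m - e) ^ 2 = 1 + M ^ 2 - 2 * m := by rw [← hsq, hdef]; ring
    linear_combination hβm - this
  have hdisc := quadratic_nonpos_of_root hq (by nlinarith) hat hue
  have : √(1 + β * u ^ 2 - 2 * u) ≤ cH * u - e :=
    Real.sqrt_le_iff.2 ⟨hpos, by linear_combination hdisc⟩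
  linarith

/-- The step size is positive and at most `2 / m`. -/
lemma step_size_bounds {m M cH cT η : ℝ} (hm : 0 < m) (hmM : m ≤ M) (hcT : 1 < cT)
    (h : rho1 cT cH m M η < 1) : 0 ≤ η ∧ η * m ≤ 2 := by
  have hs := Real.sqrt_nonneg (1 - eta0 cH m M ^ 2)
  have ht := Real.sqrt_nonneg (1 + M ^ 2 * η ^ 2 - 2 * m * η)
  have h1 : √(1 + M ^ 2 * η ^ 2 - 2 * m * η) < 1 := by
    rw [rho1] at h
    nlinarith
  have h2 : 1 + M ^ 2 * η ^ 2 - 2 * m * η < 1 := by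
    by_contra hc
    push Not at hc
    exact absurd (Real.one_le_sqrt.2 hc) (not_le.2 h1)
  have h3 : m ^ 2 * η ^ 2 ≤ M ^ 2 * η ^ 2 := by gcongr
  have h4 : η * m * (η * m) < 2 * (η * m) := by nlinarith
  have h5 : 0 < η * m := by nlinarith
  exact ⟨(pos_of_mul_pos_left h5 hm.le).le, by nlinarith⟩

/-- The assumption on the condition number of `S` that the bound on `‖L‖₂` contains. -/
lemma spectral_gap {m M cH cT η S₁ Sp R : ℝ} (hcT : 1 < cT) (hR : 0 < R) (hS : Sp ≤ S₁)
    (h : rho1 cT cH m M η < 1)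
    (hle : R ≤ Sp / (1 + √(1 - rho0 cT cH m M ^ 2))
      - S₁ * √(1 - rho0 cT cH m M ^ 2) / (1 + √(1 - rho0 cT cH m M ^ 2))) :
    0 < Sp - R ∧ 4 * (S₁ + R) ≤ 5 * (Sp - R) := by
  have hs := Real.sqrt_nonneg (1 - eta0 cH m M ^ 2)
  have ht := Real.sqrt_nonneg (1 + M ^ 2 * η ^ 2 - 2 * m * η)
  have h1 : 0 < rho0 cT cH m M := by
    rw [rho0, sub_pos, lt_div_iff₀ (by linarith)]
    rw [rho1] at h
    nlinarith
  have h2 : rho0 cT cH m M < 1 / 2 := by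
    have : 1 / (1 + cT) < 1 / 2 := one_div_lt_one_div_of_lt (by norm_num) (by linarith)
    rw [rho0]; linarith
  set q := √(1 - rho0 cT cH m M ^ 2)
  -- From `0 < ρ₀ < 1/2` one gets `q ≥ √3 / 2 > 4/5`, and `hle` rearranges to `q (S₁ + R) ≤ S_p -
  -- R`.
  have hq : 4 / 5 ≤ q := Real.le_sqrt_of_sq_le (by nlinarith)
  have hq1 : q ≤ 1 := Real.sqrt_le_one.2 (by nlinarith)
  rw [← sub_div, le_div_iff₀ (by linarith)] at hle
  have hSp : 0 < S₁ := by
    by_contra hc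
    push Not at hc
    nlinarith
  constructor <;> nlinarith

/-! ### Concentration of the Gaussian sample covariance -/

lemma mgf_sq_gaussianReal {v : NNReal} (hv : v ≠ 0) {t : ℝ} (ht : 2 * t * v < 1) :
    mgf (fun y : ℝ => y ^ 2) (gaussianReal 0 v) t = (√(1 - 2 * t * v))⁻¹ := by
  have hv0 : (0 : ℝ) < v := by positivity
  rw [mgf, integral_gaussianReal_eq_integral_smul hv]
  have h : ∀ x : ℝ, gaussianPDFReal 0 v x • Real.exp (t * x ^ 2) =
      (√(2 * Real.pi * v))⁻¹ * Real.exp (-((1 - 2 * t * v) / (2 * v)) * x ^ 2) := by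
    intro x
    rw [gaussianPDFReal, smul_eq_mul, mul_assoc, ← Real.exp_add]
    congr 2
    field_simp
    ring
  simp_rw [h]
  rw [integral_const_mul, integral_gaussian, ← Real.sqrt_inv, ← Real.sqrt_mul (by positivity),
    ← Real.sqrt_inv]
  congr 1
  have : 0 < 1 - 2 * t * v := by linarith
  field_simp

/-- This is `log (1 - y) ≥ -y - y²`, which makes the moment generating function of a centred square
sub-Gaussian near `0`. The linear bound on `exp` suffices for `y ≤ 0`, the quadratic one is needed
for `y ≥ 0`. -/
lemma exp_neg_sub_sq_le {y : ℝ} (hy : |y| ≤ 1 / 2) : Real.exp (-(y + y ^ 2)) ≤ 1 - y := by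
  obtain ⟨h1, h2⟩ := abs_le.1 hy
  rw [Real.exp_neg, inv_le_comm₀ (Real.exp_pos _) (by linarith), inv_le_iff_one_le_mul₀
    (by linarith)]
  rcases le_total 0 y with h | h
  · have hz : 0 ≤ y + y ^ 2 := by positivity
    have hq := Real.quadratic_le_exp_of_nonneg hz
    have h3 : 1 ≤ (1 + (y + y ^ 2) + (y + y ^ 2) ^ 2 / 2) * (1 - y) := by
      have e : (1 + (y + y ^ 2) + (y + y ^ 2) ^ 2 / 2) * (1 - y) =
          1 + y ^ 2 * (1 - y - y ^ 2 - y ^ 3) / 2 := by ring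
      have h4 : y ^ 2 ≤ 1 / 4 := by nlinarith
      have h5 : y ^ 3 ≤ 1 / 8 := by nlinarith
      rw [e]
      nlinarith [sq_nonneg y]
    exact h3.trans (mul_le_mul_of_nonneg_right hq (by linarith))
  · have hq := Real.add_one_le_exp (y + y ^ 2)
    have h3 : 1 ≤ (y + y ^ 2 + 1) * (1 - y) := by
      have e : (y + y ^ 2 + 1) * (1 - y) = 1 + y ^ 2 * (-y) := by ring
      rw [e]
      have := mul_nonneg (sq_nonneg y) (neg_nonneg.2 h)
      linarith
    exact h3.trans (mul_le_mul_of_nonneg_right hq (by linarith))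

lemma inv_sqrt_one_sub_le {y : ℝ} (hy : |y| ≤ 1 / 2) :
    (√(1 - y))⁻¹ ≤ Real.exp ((y + y ^ 2) / 2) := by
  have h := Real.sqrt_le_sqrt (exp_neg_sub_sq_le hy)
  rw [Real.sqrt_eq_rpow, ← Real.exp_mul] at h
  rw [← neg_neg ((y + y ^ 2) / 2), Real.exp_neg]
  refine inv_anti₀ (Real.exp_pos _) ?_
  have e : -((y + y ^ 2) / 2) = -(y + y ^ 2) * (1 / 2) := by ring
  rw [e]
  exact h

/-- Exponential moments of a sum of squares of independent centred Gaussian variables. -/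
lemma mgf_sum_sq_le {Ω : Type*} [MeasurableSpace Ω] {P : Measure Ω} [IsProbabilityMeasure P]
    {n : ℕ} {Y : Fin n → Ω → ℝ} {v : NNReal} (hv : v ≠ 0) (hY : iIndepFun Y P)
    (hlaw : ∀ i, HasLaw (Y i) (gaussianReal 0 v) P) {t : ℝ} (ht : |2 * t * v| ≤ 1 / 2) :
    Integrable (fun ω => Real.exp (t * (∑ i, fun ω => Y i ω ^ 2) ω)) P ∧
      mgf (∑ i, fun ω => Y i ω ^ 2) P t ≤ Real.exp (n * (t * v + 2 * (t * v) ^ 2)) := by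
  have hlt : 2 * t * v < 1 := by linarith [(abs_le.1 ht).2]
  have h1 : ∀ i, mgf (fun ω => Y i ω ^ 2) P t = (√(1 - 2 * t * v))⁻¹ := by
    intro i
    rw [← mgf_sq_gaussianReal hv hlt, ← (hlaw i).map_eq, mgf_map (hlaw i).aemeasurable
      (by fun_prop)]
    rfl
  have h2 : mgf (∑ i, fun ω => Y i ω ^ 2) P t = (√(1 - 2 * t * v))⁻¹ ^ n := by
    have hind : iIndepFun (fun i ω => Y i ω ^ 2) P :=
      hY.comp (fun _ y => y ^ 2) (fun _ => by fun_prop)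
    rw [hind.mgf_sum₀ (fun i => (hlaw i).aemeasurable.pow_const 2)]
    simp [h1]
  have hpos : 0 < (√(1 - 2 * t * v))⁻¹ := inv_pos.2 (Real.sqrt_pos.2 (by linarith))
  -- The integral of a non-integrable function is `0` by convention, so the positive value just
  -- computed proves integrability.
  refine ⟨Integrable.of_integral_ne_zero ?_, ?_⟩
  · change mgf (∑ i, fun ω => Y i ω ^ 2) P t ≠ 0
    rw [h2]
    exact (pow_pos hpos n).ne'
  · rw [h2, Real.exp_nat_mul]
    refine pow_le_pow_left₀ hpos.le ?_ n
    refine (inv_sqrt_one_sub_le ht).trans (le_of_eq ?_)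
    congr 1
    ring

/-- A tail bound for a sum of squares of independent centred Gaussian variables. -/
lemma measure_sum_sq_deviation_le {Ω : Type*} [MeasurableSpace Ω] {P : Measure Ω}
    [IsProbabilityMeasure P] {n p : ℕ} (hn : 0 < n) (hpn : p ≤ n)
    {Y : Fin n → Ω → ℝ} {v : NNReal} (hv : v ≠ 0) {σ : ℝ} (hvσ : v ≤ σ) (hY : iIndepFun Y P)
    (hlaw : ∀ i, HasLaw (Y i) (gaussianReal 0 v) P) :
    P.real {ω | 16 * σ * √((p : ℝ) / n) ≤ |(n : ℝ)⁻¹ * ∑ i, Y i ω ^ 2 - v|} ≤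
      2 * Real.exp (-(3 * p : ℝ)) := by
  have hv0 : (0 : ℝ) < v := by positivity
  have hσ : 0 < σ := hv0.trans_le hvσ
  have hn0 : (0 : ℝ) < n := by exact_mod_cast hn
  set q := √((p : ℝ) / n) with hq
  have hq0 : 0 ≤ q := Real.sqrt_nonneg _
  have hq2 : n * q ^ 2 = p := by
    rw [hq, Real.sq_sqrt (by positivity)]; field_simp
  have hq1 : q ≤ 1 := by
    rw [hq, Real.sqrt_le_one, div_le_one hn0]; exact_mod_cast hpn
  -- This Chernoff parameter turns the deviation `16 σ q` into the exponent `-4p`, while the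
  -- quadratic error is at most `p / 8`. The condition `p ≤ n` gives `q ≤ 1`, which keeps `t` in the
  -- admissible range.
  set t := q / (4 * σ) with ht
  have ht0 : 0 ≤ t := by positivity
  have htσ : t * σ = q / 4 := by rw [ht]; field_simp
  have htv : t * v ≤ q / 4 := by rw [← htσ]; gcongr
  have htv0 : 0 ≤ t * v := by positivity
  have hsq : 2 * (t * v) ^ 2 ≤ q ^ 2 / 8 := by nlinarith
  set Z : Ω → ℝ := ∑ i, fun ω => Y i ω ^ 2 with hZ
  have hZapp : ∀ ω, Z ω = ∑ i, Y i ω ^ 2 := fun ω => by simp [hZ]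
  have hup := mgf_sum_sq_le hv hY hlaw (t := t) (by
    rw [mul_assoc, abs_of_nonneg (by positivity)]; linarith)
  have hlo := mgf_sum_sq_le hv hY hlaw (t := -t) (by
    rw [mul_assoc, neg_mul, mul_neg, abs_neg, abs_of_nonneg (by positivity)]; linarith)
  have h1 := (measure_ge_le_exp_mul_mgf (μ := P) (n * (v + 16 * σ * q)) ht0 hup.1).trans
    (mul_le_mul_of_nonneg_left hup.2 (Real.exp_pos _).le)
  have h2 := (measure_le_le_exp_mul_mgf (μ := P) (n * (v - 16 * σ * q)) (neg_nonpos.2 ht0)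
    hlo.1).trans (mul_le_mul_of_nonneg_left hlo.2 (Real.exp_pos _).le)
  rw [← Real.exp_add] at h1 h2
  have hbound : n * (2 * (t * v) ^ 2) ≤ p / 8 := by
    rw [← hq2]; nlinarith
  have hmain : n * (t * (16 * σ * q)) = 4 * p := by
    rw [← hq2]
    linear_combination 16 * n * q * htσ
  have hp0 : (0 : ℝ) ≤ p := Nat.cast_nonneg p
  have e1 : Real.exp (-t * (n * (v + 16 * σ * q)) + n * (t * v + 2 * (t * v) ^ 2)) ≤
      Real.exp (-(3 * p : ℝ)) := by
    rw [Real.exp_le_exp]; nlinarith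
  have e2 : Real.exp (- -t * (n * (v - 16 * σ * q)) + n * (-t * v + 2 * (-t * v) ^ 2)) ≤
      Real.exp (-(3 * p : ℝ)) := by
    rw [Real.exp_le_exp]; nlinarith
  have hsub : {ω | 16 * σ * q ≤ |(n : ℝ)⁻¹ * ∑ i, Y i ω ^ 2 - v|} ⊆
      {ω | n * (v + 16 * σ * q) ≤ Z ω} ∪ {ω | Z ω ≤ n * (v - 16 * σ * q)} := by
    intro ω hω
    simp only [Set.mem_ofPred_eq, ← hZapp] at hω
    rcases le_abs.1 hω with h | h
    · left
      have h3 : v + 16 * σ * q ≤ (n : ℝ)⁻¹ * Z ω := by linarith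
      rwa [inv_mul_eq_div, le_div_iff₀ hn0, mul_comm] at h3
    · right
      have h3 : (n : ℝ)⁻¹ * Z ω ≤ v - 16 * σ * q := by linarith
      rwa [inv_mul_eq_div, div_le_iff₀ hn0, mul_comm] at h3
  calc _ ≤ _ := measureReal_mono hsub
    _ ≤ _ := measureReal_union_le _ _
    _ ≤ _ := by linarith [h1.trans e1, h2.trans e2]

/-- A net of the sphere of radius `2`. -/
lemma exists_net (p : ℕ) : ∃ s : Finset (EuclideanSpace ℝ (Fin p)), s.card ≤ 5 ^ p ∧
    (∀ c ∈ s, ‖c‖ = 2) ∧ ∀ x, ‖x‖ = 2 → ∃ c ∈ s, ‖x - c‖ ≤ 1 := by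
  classical
  let Q : Finset (EuclideanSpace ℝ (Fin p)) → Prop := fun s =>
    (∀ c ∈ s, ‖c‖ = 2) ∧ ∀ c ∈ s, ∀ d ∈ s, c ≠ d → 1 ≤ ‖c - d‖
  have hcard : ∀ s, Q s → s.card ≤ 5 ^ p := by
    intro s hs
    have := Besicovitch.card_le_of_separated s (fun c hc => (hs.1 c hc).le) hs.2
    simpa using this
  -- A 1-separated set of largest cardinality is a net, since a point farther than `1` from all of
  -- it could be added. The volume bound `5 ^ p` ensures that a largest one exists.
  obtain ⟨s, hs, hmax⟩ : ∃ s, Q s ∧ ∀ s', Q s' → s'.card ≤ s.card := by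
    have hne : ∃ k, ∃ s, Q s ∧ s.card = k := ⟨0, ∅, by simp [Q], rfl⟩
    obtain ⟨s, hs, hk⟩ := Nat.findGreatest_spec (P := fun k => ∃ s, Q s ∧ s.card = k)
      (Nat.zero_le (5 ^ p)) ⟨∅, by simp [Q], rfl⟩
    refine ⟨s, hs, fun s' hs' => ?_⟩
    rw [hk]
    exact Nat.le_findGreatest (hcard s' hs') ⟨s', hs', rfl⟩
  refine ⟨s, hcard s hs, hs.1, fun x hx => ?_⟩
  by_contra! hc
  have hxs : x ∉ s := fun h => by
    have := hc x h
    simp at this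
    linarith
  have := hmax (insert x s) ⟨fun c hc' => ?_, fun c hc' d hd hcd => ?_⟩
  · rw [Finset.card_insert_of_notMem hxs] at this
    omega
  · rcases Finset.mem_insert.1 hc' with rfl | h
    · exact hx
    · exact hs.1 c h
  · rcases Finset.mem_insert.1 hc' with rfl | h <;> rcases Finset.mem_insert.1 hd with rfl | h'
    · exact absurd rfl hcd
    · exact (hc d h').le
    · rw [norm_sub_rev]; exact (hc c h).le
    · exact hs.2 c h d h' hcd

/-- The spectral norm of a symmetric matrix is controlled by its quadratic form on a net. -/
lemma specNorm_le_of_net {p : ℕ} {N : Mat p} (hN : N.IsSymm)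
    {s : Finset (EuclideanSpace ℝ (Fin p))} (hs : ∀ c ∈ s, ‖c‖ = 2)
    (hnet : ∀ x : EuclideanSpace ℝ (Fin p), ‖x‖ = 2 → ∃ c ∈ s, ‖x - c‖ ≤ 1) {t : ℝ} (ht : 0 ≤ t)
    (h : ∀ c ∈ s, |c.ofLp ⬝ᵥ N.mulVec c.ofLp| ≤ t) : specNorm N ≤ 8 * t := by
  set T := Matrix.toEuclideanCLM (n := Fin p) (𝕜 := ℝ) N with hT
  have hQ : specNorm N = ‖T‖ := rfl
  have hsymm : ∀ u v, inner ℝ (T u) v = inner ℝ u (T v) := by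
    intro u v
    have hadj : ContinuousLinearMap.adjoint T = T := by
      have hs : star N = N := by
        rw [Matrix.star_eq_conjTranspose, Matrix.conjTranspose_eq_transpose_of_trivial, hN.eq]
      rw [← ContinuousLinearMap.star_eq_adjoint, hT, ← map_star, hs]
    rw [← ContinuousLinearMap.adjoint_inner_left, hadj]
  have hinner : ∀ x, inner ℝ x (T x) = x.ofLp ⬝ᵥ N.mulVec x.ofLp := fun x =>
    Matrix.inner_toEuclideanCLM N x x
  have hsphere : ∀ x, ‖x‖ = 2 → |inner ℝ x (T x)| ≤ t + 31 / 8 * ‖T‖ := by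
    intro x hx
    obtain ⟨c, hc, hxc⟩ := hnet x hx
    have e : inner ℝ x (T x) = inner ℝ c (T c) + inner ℝ (x - c) (T (x + c)) := by
      rw [map_add, inner_sub_left, inner_add_right, inner_add_right, ← hsymm c x,
        real_inner_comm (T c) x]
      rw [real_inner_comm x (T c)]
      ring
    have h1 := h c hc
    rw [← hinner] at h1
    have h2 : |inner ℝ (x - c) (T (x + c))| ≤ ‖x - c‖ * (‖T‖ * ‖x + c‖) :=
      (abs_real_inner_le_norm _ _).trans (by gcongr; exact T.le_opNorm _)
    -- The triangle inequality would only give `4`, which cancels against `‖x‖² = 4` and proves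
    -- nothing. The parallelogram law gives `√15 < 31/8`, and the gain of `1/8` is the source of the
    -- factor `8`.
    have h3 : ‖x - c‖ * ‖x + c‖ ≤ 31 / 8 := by
      have hpar := parallelogram_law_with_norm ℝ x c
      rw [hx, hs c hc] at hpar
      refine (sq_le_sq₀ (by positivity) (by norm_num)).1 ?_
      rw [mul_pow]
      have : ‖x + c‖ ^ 2 = 16 - ‖x - c‖ ^ 2 := by linarith
      have hw : ‖x - c‖ ^ 2 ≤ 1 := pow_le_one₀ (norm_nonneg _) hxc
      rw [this]
      nlinarith
    rw [e]
    refine (abs_add_le _ _).trans (add_le_add h1 (h2.trans ?_))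
    nlinarith [norm_nonneg T]
  have hray : ‖T‖ ≤ (t + 31 / 8 * ‖T‖) / 4 := by
    conv_lhs => rw [T.norm_eq_iSup_rayleighQuotient hsymm]
    refine ciSup_le fun x => ?_
    rw [ContinuousLinearMap.rayleighQuotient, ContinuousLinearMap.reApplyInnerSelf_apply,
      RCLike.re_to_real, abs_div, abs_of_nonneg (sq_nonneg ‖x‖)]
    rcases eq_or_ne x 0 with rfl | hx
    · simp; positivity
    · have hx0 : 0 < ‖x‖ := norm_pos_iff.2 hx
      have h4 := hsphere ((2 / ‖x‖) • x) (by
        rw [norm_smul, Real.norm_of_nonneg (by positivity)]; field_simp)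
      rw [map_smul, inner_smul_left, inner_smul_right, real_inner_comm] at h4
      simp only [conj_trivial] at h4
      rw [← mul_assoc, abs_mul, abs_of_nonneg (by positivity)] at h4
      rw [div_le_iff₀ (by positivity)]
      have h5 : 2 / ‖x‖ * (2 / ‖x‖) = 4 / ‖x‖ ^ 2 := by ring
      rw [h5, div_mul_eq_mul_div, div_le_iff₀ (by positivity)] at h4
      linarith
  rw [hQ]
  linarith

lemma hasLaw_inner_multivariateGaussian {Ω : Type*} [MeasurableSpace Ω] {P : Measure Ω} {p : ℕ}
    {Sig : Mat p} (hS : Sig.PosSemidef) {X : Ω → EuclideanSpace ℝ (Fin p)}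
    (hX : HasLaw X (multivariateGaussian 0 Sig) P) (x : EuclideanSpace ℝ (Fin p)) :
    HasLaw (fun ω => inner ℝ x (X ω))
      (gaussianReal 0 (x.ofLp ⬝ᵥ Sig.mulVec x.ofLp).toNNReal) P := by
  have h : HasLaw (fun y => inner ℝ x y)
      (gaussianReal 0 (x.ofLp ⬝ᵥ Sig.mulVec x.ofLp).toNNReal) (multivariateGaussian 0 Sig) := by
    refine ⟨by fun_prop, ?_⟩
    have h1 := IsGaussian.map_eq_gaussianReal (μ := multivariateGaussian 0 Sig) (innerSL ℝ x)
    have h2 : (multivariateGaussian 0 Sig)[innerSL ℝ x] = 0 := by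
      rw [ContinuousLinearMap.integral_comp_id_comm IsGaussian.integrable_id,
        integral_id_multivariateGaussian, map_zero]
    have h3 : Var[innerSL ℝ x; multivariateGaussian 0 Sig] = x.ofLp ⬝ᵥ Sig.mulVec x.ofLp := by
      rw [← covarianceBilin_multivariateGaussian (μ := 0) hS,
        covarianceBilin_self IsGaussian.memLp_two_id]
      rfl
    rw [h2, h3] at h1
    exact h1
  exact h.fun_comp hX

lemma dotProduct_sampleCov {p n : ℕ} (X : Fin n → EuclideanSpace ℝ (Fin p))
    (x : EuclideanSpace ℝ (Fin p)) : x.ofLp ⬝ᵥ (sampleCov X).mulVec x.ofLp =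
      (n : ℝ)⁻¹ * ∑ i, inner ℝ x (X i) ^ 2 := by
  rw [sampleCov, Matrix.smul_mulVec, Matrix.sum_mulVec, dotProduct_smul, dotProduct_sum,
    smul_eq_mul]
  congr 1
  refine Finset.sum_congr rfl fun i _ => ?_
  rw [Matrix.vecMulVec_mulVec, dotProduct_smul, EuclideanSpace.inner_eq_star_dotProduct,
    star_trivial]
  simp [dotProduct_comm, sq]

lemma isSymm_sampleCov {p n : ℕ} (X : Fin n → EuclideanSpace ℝ (Fin p)) :
    (sampleCov X).IsSymm := by
  rw [Matrix.IsSymm, sampleCov, Matrix.transpose_smul, Matrix.transpose_sum]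
  simp [Matrix.transpose_vecMulVec]

/-- Concentration of the sample covariance matrix in spectral norm. -/
theorem measure_sampleCov_deviation_le {Ω : Type*} [MeasurableSpace Ω] {P : Measure Ω}
    [IsProbabilityMeasure P] {n p : ℕ} (hp : 0 < p) (hpn : p ≤ n)
    {Sig : Mat p} (hS : Sig.PosDef) {X : Fin n → Ω → EuclideanSpace ℝ (Fin p)}
    (hX : iIndepFun X P) (hlaw : ∀ i, HasLaw (X i) (multivariateGaussian 0 Sig) P) :
    P {ω | ¬ specNorm (sampleCov (fun i => X i ω) - Sig) ≤ 512 * specNorm Sig * √((p : ℝ) / n)} ≤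
      ENNReal.ofReal (2 * Real.exp (-(p : ℝ))) := by
  obtain ⟨s, hcard, hs, hnet⟩ := exists_net p
  -- The factor `4` is `‖c‖²` on the net; altogether `16 · 4 · 8 = 512`.
  set σ := 4 * specNorm Sig with hσ
  let E : EuclideanSpace ℝ (Fin p) → Set Ω := fun c =>
    {ω | 16 * σ * √((p : ℝ) / n) ≤
      |(n : ℝ)⁻¹ * ∑ i, inner ℝ c (X i ω) ^ 2 - (c.ofLp ⬝ᵥ Sig.mulVec c.ofLp).toNNReal|}
  have hSs : Sig.IsSymm := by
    have := hS.isHermitian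
    rwa [Matrix.IsHermitian, Matrix.conjTranspose_eq_transpose_of_trivial] at this
  have hquad : ∀ c : EuclideanSpace ℝ (Fin p), ‖c‖ = 2 → 0 < c.ofLp ⬝ᵥ Sig.mulVec c.ofLp := by
    intro c hc
    have hc0 : c.ofLp ≠ 0 := fun h => by
      have : c = 0 := by ext i; exact congrFun h i
      rw [this, norm_zero] at hc; norm_num at hc
    have := hS.dotProduct_mulVec_pos hc0
    rwa [star_trivial] at this
  have hE : ∀ c ∈ s, P.real (E c) ≤ 2 * Real.exp (-(3 * p : ℝ)) := by
    intro c hc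
    have hq := hquad c (hs c hc)
    refine measure_sum_sq_deviation_le (hp.trans_le hpn) hpn (by simpa using hq) ?_ ?_
      fun i => hasLaw_inner_multivariateGaussian hS.posSemidef (hlaw i) c
    · rw [Real.coe_toNNReal _ hq.le]
      refine ((le_abs_self _).trans (abs_dotProduct_mulVec_le Sig c.ofLp)).trans ?_
      rw [← norm_toLp_sq, WithLp.toLp_ofLp, hs c hc]
      linarith
    · exact hX.comp (fun _ y => inner ℝ c y) (fun _ => by fun_prop)
  have hsub : {ω | ¬ specNorm (sampleCov (fun i => X i ω) - Sig) ≤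
      512 * specNorm Sig * √((p : ℝ) / n)} ⊆ ⋃ c ∈ s, E c := by
    intro ω hω
    by_contra hc
    refine hω ?_
    have hnn : 0 ≤ 16 * σ * √((p : ℝ) / n) := by
      have := specNorm_nonneg Sig
      positivity
    have := specNorm_le_of_net ((isSymm_sampleCov fun i => X i ω).sub hSs) hs hnet hnn
      fun c hcs => ?_
    · refine this.trans (le_of_eq ?_)
      rw [hσ]; ring
    · simp only [E, Set.mem_iUnion, Set.mem_ofPred_eq, not_exists, not_le] at hc
      have h1 := (hc c hcs).le
      rw [Real.coe_toNNReal _ (hquad c (hs c hcs)).le] at h1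
      rw [Matrix.sub_mulVec, dotProduct_sub, dotProduct_sampleCov]
      exact h1
  have hsum : P.real (⋃ c ∈ s, E c) ≤ 2 * Real.exp (-(p : ℝ)) := by
    -- The union bound over `5 ^ p ≤ exp (2p)` points uses up two of the three units in `exp (-3p)`.
    have h5 : (5 : ℝ) ≤ Real.exp 2 := by
      have h := Real.exp_one_gt_d9
      have : Real.exp 2 = Real.exp 1 * Real.exp 1 := by rw [← Real.exp_add]; norm_num
      rw [this]; nlinarith
    calc P.real (⋃ c ∈ s, E c) ≤ ∑ c ∈ s, P.real (E c) := measureReal_biUnion_finset_le _ _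
      _ ≤ ∑ _c ∈ s, 2 * Real.exp (-(3 * p : ℝ)) := Finset.sum_le_sum hE
      _ = s.card * (2 * Real.exp (-(3 * p : ℝ))) := by simp
      _ ≤ Real.exp 2 ^ p * (2 * Real.exp (-(3 * p : ℝ))) := by
        gcongr
        calc (s.card : ℝ) ≤ (5 ^ p : ℕ) := by exact_mod_cast hcard
          _ = (5 : ℝ) ^ p := by push_cast; rfl
          _ ≤ _ := by gcongr
      _ = 2 * Real.exp (-(p : ℝ)) := by
        rw [← Real.exp_nat_mul, mul_left_comm, ← Real.exp_add]
        congr 2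
        ring
  calc _ ≤ P (⋃ c ∈ s, E c) := measure_mono hsub
    _ = ENNReal.ofReal (P.real (⋃ c ∈ s, E c)) := (ofReal_measureReal (measure_ne_top P _)).symm
    _ ≤ _ := ENNReal.ofReal_le_ofReal hsum

/-! ### The invariant of the iteration -/

lemma two_le_rho2 {m M cH cT : ℝ} (hcT : 1 < cT) (he : 0 < eta0 cH m M) :
    2 ≤ rho2 cT cH m M := by
  have : 0 ≤ eta0 cH m M / √(1 - eta0 cH m M ^ 2) := div_nonneg he.le (Real.sqrt_nonneg _)
  rw [rho2]
  nlinarith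

lemma rho1_nonneg {m M cH cT η : ℝ} (hcT : 1 < cT) : 0 ≤ rho1 cT cH m M η := by
  rw [rho1]
  have : 0 ≤ 1 + cT := by linarith
  positivity

/-- The statistical error dominates the noise in each iteration. -/
lemma noise_le_statErr {m M cH cT η τ σ ν : ℝ} {p n r : ℕ} (hcT : 1 < cT)
    (hcH : 0 < cH) (hcH1 : cH < 1) (he : 0 < eta0 cH m M) (hρ : rho1 cT cH m M η < 1)
    (hτ : 0 ≤ τ) (hτm : τ * m ≤ 2) (hη : 0 ≤ η) (hηm : η * m ≤ 2)
    (hσ : 0 ≤ σ) (hσm : σ ≤ 2 * m) (hν : ν ≤ 512 * σ * √((p : ℝ) / n)) :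
    (1 + cT) * (eta0 cH m M / √(1 - eta0 cH m M ^ 2) * ((1 + cH) * τ) + η) *
        (√((2 * r : ℕ) : ℝ) * ν) ≤
      (1 - rho1 cT cH m M η) * statErr 8192 cT cH m M η p n r := by
  set f := eta0 cH m M / √(1 - eta0 cH m M ^ 2) with hf
  have hf0 : 0 ≤ f := div_nonneg he.le (Real.sqrt_nonneg _)
  set w := √((p : ℝ) / n)
  have hw : 0 ≤ w := Real.sqrt_nonneg _
  have e1 : (1 - rho1 cT cH m M η) * statErr 8192 cT cH m M η p n r =
      8192 * ((f + 1) * (1 + cT)) * (√(r : ℝ) * w) := by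
    have h1 : √((r : ℝ) * p / n) = √(r : ℝ) * w := by
      rw [mul_div_assoc, Real.sqrt_mul (Nat.cast_nonneg r)]
    have h2 : 1 - rho1 cT cH m M η ≠ 0 := by linarith
    rw [statErr, h1, rho2, ← hf]
    field_simp
  have h2r : √((2 * r : ℕ) : ℝ) ≤ 2 * √(r : ℝ) := by
    rw [Real.sqrt_le_left (by positivity), mul_pow, Real.sq_sqrt (Nat.cast_nonneg r)]
    push_cast
    nlinarith [(Nat.cast_nonneg r : (0 : ℝ) ≤ r)]
  have h1 : √((2 * r : ℕ) : ℝ) * ν ≤ 2 * √(r : ℝ) * (512 * σ * w) := by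
    refine (mul_le_mul_of_nonneg_left hν (Real.sqrt_nonneg _)).trans ?_
    gcongr
  have hτσ : τ * σ ≤ 4 := by nlinarith
  have hησ : η * σ ≤ 4 := by nlinarith
  -- Here `m` drops out: `τ` and `η` are at most `2 / m` while `σ ≤ 2 m`. Together with `2 · 512`
  -- from `h1`, the factor `8` gives `8192`.
  have h3 : (f * ((1 + cH) * τ) + η) * σ ≤ 8 * (f + 1) := by
    have h4 : (1 + cH) * (τ * σ) ≤ 8 := by nlinarith [mul_nonneg hτ hσ]
    have h5 := mul_le_mul_of_nonneg_left h4 hf0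
    nlinarith
  have hT : 0 ≤ 1 + cT := by linarith
  rw [e1]
  calc _ ≤ (1 + cT) * (f * ((1 + cH) * τ) + η) * (2 * √(r : ℝ) * (512 * σ * w)) := by
        gcongr
    _ = 1024 * (1 + cT) * (√(r : ℝ) * w) * ((f * ((1 + cH) * τ) + η) * σ) := by ring
    _ ≤ 1024 * (1 + cT) * (√(r : ℝ) * w) * (8 * (f + 1)) := by gcongr
    _ = _ := by ring

/-- A bound on all iterates, on the event that the sample covariance is close to its mean. -/
lemma minEigAtLeast_apLVM {p n r : ℕ} (hp : 0 < p) {S L C : Mat p} (hS : S.IsHermitian)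
    (hLr : L.rank ≤ r) {cT cH m M η τ σ : ℝ} (hcT : 1 < cT)
    (hcH : 0 < cH) (hcH1 : cH < 1) (he : 0 < eta0 cH m M) (he1 : eta0 cH m M < 1)
    (hρ : rho1 cT cH m M η < 1) (hτ : 0 ≤ τ) (hτm : τ * m ≤ 2)
    (heτ : eta0 cH m M ≤ cH * m * τ - √(1 + M ^ 2 * τ ^ 2 - 2 * m * τ))
    (hη : 0 ≤ η) (hηm : η * m ≤ 2) (hσ : 0 ≤ σ) (hσm : σ ≤ 2 * m)
    (hE : 0 < statErr 8192 cT cH m M η p n r)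
    (hl : 0 < minEig S - radius 8192 cT cH m M η n r L)
    (hlh : 4 * (maxEig S + radius 8192 cT cH m M η n r L) ≤
      5 * (minEig S - radius 8192 cT cH m M η n r L))
    (hmh : m ≤ 1 / (maxEig S + radius 8192 cT cH m M η n r L) ^ 2)
    (hMl : 1 / (minEig S - radius 8192 cT cH m M η n r L) ^ 2 ≤ M)
    (hC : specNorm (C - (S + L)⁻¹) ≤ 512 * σ * √((p : ℝ) / n))
    {𝓣 𝓗 : ℕ → Mat p → Submodule ℝ (Mat p)} (h𝓣 : ∀ t, IsTailProj r cT (𝓣 t))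
    (h𝓗 : ∀ t, IsHeadProj (2 * r) cH (𝓗 t)) (t : ℕ) :
    MinEigAtLeast (apLVM 𝓣 𝓗 S C η t) (-radius 8192 cT cH m M η n r L) := by
  have hSn := specNorm_isHermitian_sub_le hp hS
  have hS1 : 0 ≤ (maxEig S - minEig S) / 2 := (specNorm_nonneg _).trans hSn
  have hLn := specNorm_nonneg L
  have hsr := Real.sqrt_nonneg (r : ℝ)
  set E := statErr 8192 cT cH m M η p n r with hEdef
  have hR : radius 8192 cT cH m M η n r L = (1 + √(r : ℝ)) * specNorm L + E := rfl
  set R := radius 8192 cT cH m M η n r L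
  have hR0 : 0 < R := by rw [hR]; positivity
  have hρ0 := rho1_nonneg (m := m) (M := M) (cH := cH) (η := η) hcT
  set a := (maxEig S + minEig S) / 2 with ha
  set b := (maxEig S - minEig S) / 2 + R with hb
  have hab : a + b = maxEig S + R := by rw [ha, hb]; ring
  have hab' : a - b = minEig S - R := by rw [ha, hb]; ring
  have hshift : ∀ K : Mat p, specNorm K ≤ R → specNorm (S + K - a • (1 : Mat p)) ≤ b := by
    intro K hK
    have : S + K - a • (1 : Mat p) = (S - a • (1 : Mat p)) + K := by abel
    rw [this]
    exact (specNorm_add_le _ _).trans (add_le_add hSn hK)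
  have hLR : specNorm L ≤ R := by rw [hR]; nlinarith
  -- The ratio `5/4` between `a + b` and `a - b` gives `a ≥ 9/10 (a + b)`, and `2 · 0.81 > 1`.
  have hab2 : (a + b) ^ 2 < 2 * a ^ 2 := by
    have h1 : 9 / 10 * (a + b) ≤ a := by linarith
    have h2 : 0 < a + b := by linarith
    nlinarith
  have hspec : ∀ K : Mat p, frobNorm (K - L) ≤ √(r : ℝ) * specNorm L + E → specNorm K ≤ R := by
    intro K hK
    have h1 : K = L + (K - L) := by abel
    rw [h1, hR]
    have h2 := specNorm_add_le L (K - L)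
    have h3 := specNorm_le_frobNorm (K - L)
    linarith
  -- The bound keeps the iterate in the ball of radius `R` where the curvature constants are valid,
  -- so it reproduces itself.
  have key : ∀ t, (apLVM 𝓣 𝓗 S C η t).rank ≤ r ∧
      frobNorm (apLVM 𝓣 𝓗 S C η t - L) ≤ √(r : ℝ) * specNorm L + E := by
    intro t
    induction t with
    | zero =>
      refine ⟨by simp [apLVM], ?_⟩
      have h1 : frobNorm (apLVM 𝓣 𝓗 S C η 0 - L) = frobNorm L := by
        rw [apLVM, zero_sub, frobNorm, map_neg, norm_neg]; rfl
      rw [h1]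
      linarith [frobNorm_le_of_rank_le hLr]
    | succ t ih =>
      set K := apLVM 𝓣 𝓗 S C η t
      obtain ⟨hKr, hKL⟩ := ih
      obtain ⟨hc1, hc2⟩ := grad_curvature C (by positivity) (by linarith) hab2
        (hshift K (hspec K hKL)) (hshift L hLR)
      rw [hab] at hc1
      rw [hab'] at hc2
      have hstep := frobNorm_step_le (N := grad S C L) hτ hη hcH.le (by linarith) he he1 heτ
        ((mul_le_mul_of_nonneg_right hmh (sq_nonneg _)).trans hc1)
        (hc2.trans (mul_le_mul_of_nonneg_right hMl (frobNorm_nonneg _))) hKr hLr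
        (h𝓣 t) (h𝓗 t) rfl
      have hN : grad S C L = C - (S + L)⁻¹ := by rw [grad]; abel
      have hnoise := noise_le_statErr (r := r) hcT hcH hcH1 he hρ hτ hτm hη hηm hσ hσm hC
      rw [← hN, ← hEdef] at hnoise
      refine ⟨rank_le_of_mem_rankSubspaces ((h𝓣 t) _).1 (proj_mem _ _), ?_⟩
      refine hstep.trans ((add_le_add_right hnoise _).trans ?_)
      change rho1 cT cH m M η * frobNorm (K - L) + _ ≤ _
      have h1 := mul_le_mul_of_nonneg_left hKL hρ0
      have h2 : 0 ≤ √(r : ℝ) * specNorm L := by positivity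
      have h3 := mul_le_of_le_one_left h2 hρ.le
      linarith
  refine minEigAtLeast_of_forall fun x => ?_
  have h1 := (abs_le.1 (abs_dotProduct_mulVec_le (apLVM 𝓣 𝓗 S C η t) x)).1
  have h2 := hspec _ (key t).2
  have h3 : 0 ≤ x ⬝ᵥ x := by rw [← norm_toLp_sq]; positivity
  nlinarith

end LVM

end

/-! ### From the assumptions to the good event -/

theorem theorem5 :
    -- an absolute constant
    ∃ c₃ : ℝ, 0 < c₃ ∧
    ∀ (p n r T : ℕ), 0 < p → 0 < n → 0 < r →
    -- the true parameters: sparse part `S`, low-rank part `L`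
    ∀ (S L : LVM.Mat p), S.PosDef → L.IsSymm → L.rank ≤ r →
    -- constants of the approximate projections, curvature constants, step size
    ∀ (cT cH m M η : ℝ), 1 < cT → 0 < cH → cH < 1 → 0 < m →
      0 < LVM.eta0 cH m M → LVM.rho1 cT cH m M η < 1 →
      -- the assumption on `‖L‖₂`
      LVM.specNorm L ≤ 1 / (1 + √(r : ℝ)) *
        (LVM.minEig S / (1 + √(1 - LVM.rho0 cT cH m M ^ 2))
          - LVM.maxEig S * √(1 - LVM.rho0 cT cH m M ^ 2) / (1 + √(1 - LVM.rho0 cT cH m M ^ 2))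
          - LVM.statErr c₃ cT cH m M η p n r) →
      -- `m`, `M` are restricted strong convexity / smoothness constants of `F` on the matrices of
      -- spectral norm at most `radius`, where `S + L'` has its spectrum in `[S_p - R, S_1 + R]`
      m ≤ 1 / (LVM.maxEig S + LVM.radius c₃ cT cH m M η n r L) ^ 2 →
      1 / (LVM.minEig S - LVM.radius c₃ cT cH m M η n r L) ^ 2 ≤ M →
    -- i.i.d. samples from `N(0, (S + L)⁻¹)`
    ∀ (Ω : Type*) [MeasurableSpace Ω] (P : Measure Ω) [IsProbabilityMeasure P]
      (X : Fin n → Ω → EuclideanSpace ℝ (Fin p)),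
      iIndepFun X P → (∀ i, HasLaw (X i) (multivariateGaussian 0 (S + L)⁻¹) P) →
    -- approximate tail and head projections, which may be random
    ∀ (𝓣 𝓗 : Ω → ℕ → LVM.Mat p → Submodule ℝ (LVM.Mat p)),
      (∀ ω t, LVM.IsTailProj r cT (𝓣 ω t)) → (∀ ω t, LVM.IsHeadProj (2 * r) cH (𝓗 ω t)) →
      ∃ a : ℝ, 0 < a ∧ a ≤ LVM.radius c₃ cT cH m M η n r L ∧
        P {ω | ¬ ∀ t, 1 ≤ t → t ≤ T → LVM.MinEigAtLeast
            (LVM.apLVM (𝓣 ω) (𝓗 ω) S (LVM.sampleCov fun i => X i ω) η t) (-a)}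
          ≤ ENNReal.ofReal (2 * Real.exp (-(p : ℝ))) := by
  refine ⟨8192, by norm_num, ?_⟩
  intro p n r T hp hn hr S L hS hLs hLr cT cH m M η hcT hcH hcH1 hm he hρ hL hmh hMl Ω _ P _ X
    hX hlaw 𝓣 𝓗 h𝓣 h𝓗
  have hn0 : (0 : ℝ) < n := by exact_mod_cast hn
  have hp0 : (0 : ℝ) < p := by exact_mod_cast hp
  have hr1 : (1 : ℝ) ≤ r := by exact_mod_cast hr
  have hSn := LVM.specNorm_isHermitian_sub_le hp hS.isHermitian
  have hS1 : LVM.minEig S ≤ LVM.maxEig S := by linarith [(LVM.specNorm_nonneg _).trans hSn]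
  have hLn := LVM.specNorm_nonneg L
  have hρ0 := LVM.rho1_nonneg (m := m) (M := M) (cH := cH) (η := η) hcT
  have hρ2 := LVM.two_le_rho2 hcT he
  set E := LVM.statErr 8192 cT cH m M η p n r with hEdef
  have hE0 : 0 < E := by
    have h1 : 0 < 1 - LVM.rho1 cT cH m M η := by linarith
    have h2 : 0 < LVM.rho2 cT cH m M := by linarith
    rw [hEdef, LVM.statErr]
    positivity
  have hEle : √((p : ℝ) / n) ≤ E / 2 := by
    have h1 : √((p : ℝ) / n) ≤ √((r : ℝ) * p / n) := by
      apply Real.sqrt_le_sqrt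
      rw [mul_div_assoc]
      exact le_mul_of_one_le_left (by positivity) hr1
    have h2 : 2 ≤ 8192 * LVM.rho2 cT cH m M / (1 - LVM.rho1 cT cH m M η) := by
      rw [le_div_iff₀ (by linarith)]
      linarith
    rw [hEdef, LVM.statErr]
    nlinarith [Real.sqrt_nonneg ((r : ℝ) * p / n)]
  have hRdef : LVM.radius 8192 cT cH m M η n r L = (1 + √(r : ℝ)) * LVM.specNorm L + E := rfl
  have hR0 : 0 < LVM.radius 8192 cT cH m M η n r L := by rw [hRdef]; positivity
  have hER : E ≤ LVM.radius 8192 cT cH m M η n r L := by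
    rw [hRdef]; exact le_add_of_nonneg_left (by positivity)
  have hLR : LVM.specNorm L ≤ LVM.radius 8192 cT cH m M η n r L := by
    rw [hRdef]; nlinarith [Real.sqrt_nonneg (r : ℝ)]
  have hRle : LVM.radius 8192 cT cH m M η n r L ≤
      LVM.minEig S / (1 + √(1 - LVM.rho0 cT cH m M ^ 2))
        - LVM.maxEig S * √(1 - LVM.rho0 cT cH m M ^ 2) /
          (1 + √(1 - LVM.rho0 cT cH m M ^ 2)) := by
    rw [one_div_mul_eq_div, le_div_iff₀ (by positivity)] at hL
    rw [hRdef]; linarith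
  obtain ⟨hl, hlh⟩ := LVM.spectral_gap hcT hR0 hS1 hρ hRle
  set R := LVM.radius 8192 cT cH m M η n r L
  have hmM : m ≤ M := by
    refine hmh.trans (le_trans ?_ hMl)
    exact one_div_le_one_div_of_le (by positivity) (pow_le_pow_left₀ hl.le (by linarith) 2)
  obtain ⟨he1, hm2, hM2, τ, hτ, hτm, heτ⟩ := LVM.exists_scaling hm hmM hcH hcH1 he
  obtain ⟨hη, hηm⟩ := LVM.step_size_bounds hm hmM hcT hρ
  -- Since `m > 1/2`, the curvature condition gives `(S₁ + R)² ≤ 2`, so `E ≤ R` is bounded by `2`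
  -- and `√(p/n) ≤ E / 2` by `1`.
  have hpn : p ≤ n := by
    have h1 : (LVM.maxEig S + R) ^ 2 ≤ 2 := by
      have h0 : 0 < (LVM.maxEig S + R) ^ 2 := pow_pos (by linarith) 2
      rw [le_div_iff₀ h0] at hmh
      nlinarith
    have h2 : E ≤ 2 := by nlinarith
    have h3 : √((p : ℝ) / n) ≤ 1 := by linarith
    rw [Real.sqrt_le_one, div_le_one hn0] at h3
    exact_mod_cast h3
  have hcent : LVM.specNorm
      (S + L - ((LVM.maxEig S + LVM.minEig S) / 2) • (1 : LVM.Mat p)) ≤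
      (LVM.maxEig S - LVM.minEig S) / 2 + R := by
    rw [add_sub_right_comm]
    exact (LVM.specNorm_add_le _ _).trans (add_le_add hSn hLR)
  have hSs : S.IsSymm := by
    have := hS.isHermitian
    rwa [Matrix.IsHermitian, Matrix.conjTranspose_eq_transpose_of_trivial] at this
  have hpd : (S + L)⁻¹.PosDef :=
    (LVM.posDef_of_specNorm_sub_le (by linarith) (hSs.add hLs) hcent).inv
  -- The square of the norm is at most `(S_p - R)⁻² ≤ M ≤ 2 m`, and `2 m ≤ (2 m)²` because `m >
  -- 1/2`.
  have hσ : LVM.specNorm (S + L)⁻¹ ≤ 2 * m := by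
    have h1 := LVM.specNorm_inv_le (by linarith) (by linarith) hcent
    have h2 : (LVM.maxEig S + LVM.minEig S) / 2 - ((LVM.maxEig S - LVM.minEig S) / 2 + R) =
        LVM.minEig S - R := by ring
    rw [h2] at h1
    have h3 : LVM.specNorm (S + L)⁻¹ ^ 2 ≤ M := by
      refine (pow_le_pow_left₀ (LVM.specNorm_nonneg _) h1 2).trans (le_trans (le_of_eq ?_) hMl)
      rw [inv_pow, one_div]
    refine (sq_le_sq₀ (LVM.specNorm_nonneg _) (by linarith)).1 (h3.trans ?_)
    have hM : M ≤ 2 * m :=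
      (sq_le_sq₀ (by linarith) (by linarith)).1
        (hM2.trans (by linarith [mul_pow 2 m 2, sq_nonneg m]))
    have hm3 : 1 / 2 * m ≤ m * m := mul_le_mul_of_nonneg_right hm2.le hm.le
    linarith [mul_pow 2 m 2, sq m]
  refine ⟨R, hR0, le_rfl, ?_⟩
  -- The failure event lies in the deviation event of the covariance, so the random projections need
  -- not be measurable.
  refine le_trans (measure_mono fun ω hω => ?_)
    (LVM.measure_sampleCov_deviation_le hp hpn hpd hX hlaw)
  intro hC
  exact hω fun t _ _ => LVM.minEigAtLeast_apLVM hp hS.isHermitian hLr hcT hcH hcH1 he he1 hρ hτ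
    hτm heτ hη hηm (LVM.specNorm_nonneg _) hσ hE0 hl hlh hmh hMl hC (h𝓣 ω) (h𝓗 ω) t
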